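/- Let $q\ge 0$ be an integer and let $\mathfrak X$ be the $(q+1)$-regular tree. For each $N\in\mathbb N$ let $\Gamma_N$ be a group of automorphisms of $\mathfrak X$ acting without fixed vertices (no $\gamma\neq 1$ in $\Gamma_N$ fixes a vertex) such that the quotient graph $G_N=\Gamma_N\backslash\mathfrak X$, which may have loops and multiple edges, has a finite vertex set $V_N$; assume $|V_N|\to\infty$ as $N\to\infty$. The adjacency operator $\mathcal A f(x)=\sum_{y\sim x}f(y)$ on functions on the vertices of $\mathfrak X$ preserves the $\Gamma_N$-invariant functions, which are identified with the functions on $V_N$; it thus defines an operator $\mathcal A$ on $\ell^2(V_N)$ (complex-valued functions, $\langle f,g\rangle=\sum_{x\in V_N}\overline{f(x)}g(x)$). Assume: (EXP) there is $\beta>0$ such that for all $N$ the spectrum of $(q+1)^{-1}\mathcal A$ on $\ell^2(V_N)$ is contained in $\{1\}\cup[-1+\beta,1-\beta]$; (BST) for every $R$, $\frac{1}{|V_N|}\,|\{x\in V_N:\rho(x)<R\}|\to 0$ as $N\to\infty$, where the injectivity radius $\rho(x)$ is the largest integer $\rho\ge 0$ such that the ball $B(x,\rho)$ in $G_N$ (as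 an induced subgraph) is a tree, with $\rho(x)=0$ if there is none. For each $N$ let $(\psi^{(N)}_1,\dots,\psi^{(N)}_{|V_N|})$ be an orthonormal basis of $\ell^2(V_N)$ consisting of eigenfunctions of $\mathcal A$, and let $a_N:V_N\to\mathbb C$ satisfy $|a_N(x)|\le 1$ for all $N$ and all $x\in V_N$. Put $\langle a_N\rangle=\frac1{|V_N|}\sum_{x\in V_N}a_N(x)$. Then $$\frac1{|V_N|}\sum_{j=1}^{|V_N|}\left|\left\langle\psi^{(N)}_j,a_N\psi^{(N)}_j\right\rangle_{\ell^2(V_N)}-\langle a_N\rangle\right|^2\longrightarrow 0\qquad (N\to\infty),$$ where $\langle\psi^{(N)}_j,a_N\psi^{(N)}_j\rangle_{\ell^2(V_N)}=\sum_{x\in V_N}a_N(x)|\psi^{(N)}_j(x)|^2$. -/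

import Mathlib

open Filter Topology

namespace QuantumErgodicity

universe u

variable {T : Type u}

/-- Graph automorphisms act on the oriented edges (darts) of a graph. -/
instance dartAction (X : SimpleGraph T) : MulAction (X ≃g X) X.Dart where
  smul g d := ⟨(g d.fst, g d.snd), g.map_rel_iff.2 d.adj⟩
  one_smul _ := rfl
  mul_smul _ _ _ := rfl

/-- The group `Γ` of automorphisms acts without fixed vertices: only the identity of `Γ`
fixes a vertex. -/
def ActsFreely (X : SimpleGraph T) (Γ : Subgroup (X ≃g X)) : Prop :=
  ∀ g ∈ Γ, ∀ x : T, g x = x → g = 1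

/-- The vertex set `Γ \ V(X)` of the quotient graph `Γ \ X`. -/
abbrev Vert (X : SimpleGraph T) (Γ : Subgroup (X ≃g X)) : Type u :=
  MulAction.orbitRel.Quotient Γ T

/-- The set `Γ \ B(X)` of oriented edges of the quotient graph. The quotient may have loops and
multiple edges. -/
abbrev OEdge (X : SimpleGraph T) (Γ : Subgroup (X ≃g X)) : Type u :=
  MulAction.orbitRel.Quotient Γ X.Dart

section Quotient

variable (X : SimpleGraph T) (Γ : Subgroup (X ≃g X))

/-- The class in the quotient graph of a vertex of `X`. -/
def proj (x : T) : Vert X Γ := Quotient.mk _ x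

theorem proj_eq_proj_iff {x y : T} : proj X Γ x = proj X Γ y ↔ ∃ g ∈ Γ, g y = x := by
  unfold proj
  rw [Quotient.eq, MulAction.orbitRel_apply]
  constructor
  · rintro ⟨g, hg⟩
    exact ⟨g.1, g.2, hg⟩
  · rintro ⟨g, hg, h⟩
    exact ⟨⟨g, hg⟩, h⟩

/-- The origin of an oriented edge of the quotient graph. -/
def origin : OEdge X Γ → Vert X Γ :=
  Quotient.lift (fun d : X.Dart => proj X Γ d.fst) (by
    rintro a b ⟨g, rfl⟩
    exact (proj_eq_proj_iff X Γ).2 ⟨g.1, g.2, rfl⟩)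

/-- The terminus of an oriented edge of the quotient graph. -/
def terminus : OEdge X Γ → Vert X Γ :=
  Quotient.lift (fun d : X.Dart => proj X Γ d.snd) (by
    rintro a b ⟨g, rfl⟩
    exact (proj_eq_proj_iff X Γ).2 ⟨g.1, g.2, rfl⟩)

/-- The simple graph underlying the quotient graph, in which loops and multiplicities of edges
are forgotten. It has the same distance as the quotient graph. -/
def underlying : SimpleGraph (Vert X Γ) where
  Adj v w := v ≠ w ∧ ∃ e : OEdge X Γ, origin X Γ e = v ∧ terminus X Γ e = w
  symm := ⟨by
    rintro v w ⟨hne, e, rfl, rfl⟩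
    refine ⟨hne.symm, ?_⟩
    induction e using Quotient.inductionOn with
    | h d => exact ⟨Quotient.mk _ d.symm, rfl, rfl⟩⟩
  loopless := ⟨fun _ h => h.1 rfl⟩

/-- The set of vertices of the closed ball `B(v, r)` of the quotient graph. -/
def ball (v : Vert X Γ) (r : ℕ) : Set (Vert X Γ) :=
  {w | (underlying X Γ).edist v w ≤ r}

/-- The ball `B(v, r)`, as an induced subgraph of the quotient graph, is a tree: it contains no
loop, no multiple edge, and its underlying simple graph is a tree. -/
def BallIsTree (v : Vert X Γ) (r : ℕ) : Prop :=
  (∀ e : OEdge X Γ, origin X Γ e ∈ ball X Γ v r → terminus X Γ e ∈ ball X Γ v r →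
      origin X Γ e ≠ terminus X Γ e) ∧
  (∀ e e' : OEdge X Γ, origin X Γ e ∈ ball X Γ v r → terminus X Γ e ∈ ball X Γ v r →
      origin X Γ e = origin X Γ e' → terminus X Γ e = terminus X Γ e' → e = e') ∧
  ((underlying X Γ).induce (ball X Γ v r)).IsTree

/-- The injectivity radius `ρ(v)`: the largest `r` such that `B(v, r)` is a tree
(it is `0` if there is no such `r`, that is, if there is a loop at `v`). -/
noncomputable def injRadius (v : Vert X Γ) : ℕ∞ :=
  ⨆ (r : ℕ) (_ : BallIsTree X Γ v r), (r : ℕ∞)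

variable [X.LocallyFinite]

/-- The adjacency operator `f ↦ (x ↦ ∑_{y ∼ x} f y)` on functions on the vertices of `X`. -/
def adjFun (f : T → ℂ) (x : T) : ℂ := ∑ y ∈ X.neighborFinset x, f y

/-- The adjacency operator preserves `Γ`-invariant functions. -/
theorem adjFun_invariant (f : T → ℂ) (hf : ∀ g ∈ Γ, ∀ x, f (g x) = f x) :
    ∀ g ∈ Γ, ∀ x, adjFun X f (g x) = adjFun X f x := by
  intro g hg x
  unfold adjFun
  symm
  refine Finset.sum_bij' (fun y _ => g y) (fun y _ => g.symm y) ?_ ?_ ?_ ?_ ?_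
  · intro y hy
    rw [SimpleGraph.mem_neighborFinset] at hy ⊢
    exact g.map_adj_iff.2 hy
  · intro y hy
    rw [SimpleGraph.mem_neighborFinset] at hy ⊢
    rw [← g.map_adj_iff]
    simpa using hy
  · intro y _
    simp
  · intro y _
    simp
  · intro y _
    exact (hf g hg y).symm

/-- The adjacency operator on functions on the quotient graph, such functions being identified
with the `Γ`-invariant functions on the vertices of `X`. -/
def quotAdjFun (f : Vert X Γ → ℂ) : Vert X Γ → ℂ :=
  Quotient.lift (adjFun X (fun x => f (proj X Γ x))) (by
    rintro a b ⟨g, rfl⟩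
    refine adjFun_invariant X Γ _ ?_ g.1 g.2 b
    intro h hh x
    exact congrArg f ((proj_eq_proj_iff X Γ).2 ⟨h, hh, rfl⟩))

/-- The adjacency operator on `ℓ²` of the vertices of the (finite) quotient graph. -/
noncomputable def adjOp [Fintype (Vert X Γ)] :
    Module.End ℂ (EuclideanSpace ℂ (Vert X Γ)) where
  toFun f := WithLp.toLp 2 (quotAdjFun X Γ f)
  map_add' f g := by
    ext v
    induction v using Quotient.inductionOn with
    | h x => exact Finset.sum_add_distrib
  map_smul' c f := by
    ext v
    induction v using Quotient.inductionOn with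
    | h x => exact (Finset.mul_sum _ _ _).symm

end Quotient

section Sequences

variable (X : SimpleGraph T) (Γ : ℕ → Subgroup (X ≃g X))

/-- Uniform expansion of a sequence of finite quotients of the `(q+1)`-regular tree: the spectra
of the normalized adjacency operators lie in `{1} ∪ [-1 + β, 1 - β]` for a common `β > 0`. -/
def IsExpanding [X.LocallyFinite] [∀ N, Fintype (Vert X (Γ N))] (q : ℕ) : Prop :=
  ∃ β : ℝ, 0 < β ∧ ∀ N, spectrum ℂ (((q : ℂ) + 1)⁻¹ • adjOp X (Γ N)) ⊆
    (fun t : ℝ => (t : ℂ)) '' ({1} ∪ Set.Icc (-1 + β) (1 - β))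

/-- Benjamini-Schramm convergence to the tree: for each `R`, the proportion of vertices with
injectivity radius less than `R` tends to `0`. -/
def ConvergesToTree [∀ N, Fintype (Vert X (Γ N))] : Prop :=
  ∀ R : ℕ, Tendsto
    (fun N => ({v : Vert X (Γ N) | injRadius X (Γ N) v < R}.ncard : ℝ)
      / (Fintype.card (Vert X (Γ N)) : ℝ)) atTop (𝓝 0)

end Sequences

end QuantumErgodicity

/-!
The proof rests on the product formula for Chebyshev polynomials. Let `D_n` be the Dickson
polynomials with parameter `q`, that is, rescaled Chebyshev polynomials of the first kind, let `x_j`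
be the eigenvalues of the adjacency operator on the quotient, and let `b = a - ⟨a⟩`.

*Time averages.* The averages of `q⁻ⁿ D_n(t)²` over `n < 2M` are bounded below uniformly in real
`t` (`le_sum_dickson_sq`), so the sum of `|⟨ψ_j, b ψ_j⟩|²` is at most a constant times the
Hilbert-Schmidt sum over `i, j` of `|⟨ψ_i, b ψ_j⟩|²` weighted by the square of the average of
`q⁻ⁿ D_n(x_i) D_n(x_j)`. Expanding the square and using
`D_m D_{m+k} = D_{2m+k} + q^m D_k` (`dickson_mul_dickson`) leaves sums of
`|⟨ψ_i, b ψ_j⟩|² D_k(x_i) D_l(x_j)`, and `sum_diag_le` says that it is enough to bound each of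
these by a constant times `r ^ min k l` with `r < q`.

*Kernels.* By the trace formula, such a sum is a quadratic form in `b` whose kernel is the entrywise
product of the kernels of `D_k` and `D_l`. On the tree these kernels are radial, with coefficients
bounded independently of the degree (`exists_dickson_eq_sum`), and the entrywise product of the
indicators of two spheres is zero or one of them. On the quotient the same holds at every vertex
whose injectivity radius is large, because balls lift injectively there
(`proj_injOn_of_le_injRadius`), and the exceptional vertices are few by Benjamini-Schramm
convergence (`abs_sum_matrixCoeff_sub_le`).

*Spectral gap.* Since `b` is orthogonal to the constants, which are the only eigenfunctions for
`q + 1`, the quadratic form of the sphere operator of radius `d` at `b` is `O(r ^ d)` times the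
number of vertices, for some `r < q` (`exists_abs_sphereEval_le`, by a Lyapunov function for the
recurrence of the spherical functions). Summing over `d ≤ min k l` gives the required bound.

For `q ≤ 1` the hypotheses cannot hold: the `1`-regular tree has two vertices, and quotients of the
line of unbounded size have no uniform spectral gap (`exists_card_vert_le`).
-/

/-! ### Spheres in regular trees -/

namespace SimpleGraph

variable {V : Type*} {G : SimpleGraph V}

/-- In a tree rooted at `x`, the parent of a vertex is unique. -/
theorem IsTree.eq_of_adj_of_dist_eq (hG : G.IsTree) {x y w w' : V} (hw : G.Adj w y)
    (hw' : G.Adj w' y) (hd : G.dist x y = G.dist x w + 1) (hd' : G.dist x y = G.dist x w' + 1) :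
    w = w' := by
  obtain ⟨p, -, hp⟩ := hG.connected.exists_path_of_dist x w
  obtain ⟨p', -, hp'⟩ := hG.connected.exists_path_of_dist x w'
  have h1 : (p.concat hw).IsPath :=
    Walk.isPath_of_length_eq_dist _ (by rw [Walk.length_concat, hp, hd])
  have h2 : (p'.concat hw').IsPath :=
    Walk.isPath_of_length_eq_dist _ (by rw [Walk.length_concat, hp', hd'])
  have h := (hG.existsUnique_path x y).unique h1 h2
  have := congrArg Walk.penultimate h
  simpa using this

theorem Connected.exists_adj_dist_eq (hG : G.Connected) {x y : V} {n : ℕ}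
    (h : G.dist x y = n + 1) : ∃ w, G.Adj w y ∧ G.dist x w = n := by
  obtain ⟨p, hp⟩ := hG.exists_walk_length_eq_dist x y
  have hnil : ¬ p.Nil := by
    intro hn
    rw [← Walk.length_eq_zero_iff] at hn
    omega
  refine ⟨p.penultimate, p.adj_penultimate hnil, ?_⟩
  have h1 : G.dist x p.penultimate ≤ n := by
    have := dist_le p.dropLast
    rw [Walk.length_dropLast] at this
    omega
  have h2 := (p.adj_penultimate hnil).diff_dist_adj (u := x)
  omega

end SimpleGraph

namespace QuantumErgodicity

variable {T : Type*} (X : SimpleGraph T) [X.LocallyFinite]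

open Classical in
/-- The sphere of radius `n` about `x`, as a finset; in a connected graph it consists of the
vertices at distance `n` from `x`. -/
noncomputable def sphere (x : T) : ℕ → Finset T
  | 0 => {x}
  | n + 1 => ((sphere x n).biUnion (fun z => X.neighborFinset z)).filter
      (fun y => X.dist x y = n + 1)

variable {X}

theorem mem_sphere (hX : X.Connected) {x y : T} {n : ℕ} :
    y ∈ sphere X x n ↔ X.dist x y = n := by
  induction n generalizing y with
  | zero =>
    rw [sphere, Finset.mem_singleton, hX.dist_eq_zero_iff, eq_comm]
  | succ n ih =>
    classical
    rw [sphere, Finset.mem_filter, Finset.mem_biUnion]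
    refine ⟨fun h => h.2, fun h => ⟨?_, h⟩⟩
    obtain ⟨w, hw, hd⟩ := hX.exists_adj_dist_eq h
    exact ⟨w, ih.2 hd, by rwa [SimpleGraph.mem_neighborFinset]⟩

theorem card_neighbor_dist_pred (hX : X.IsTree) {x z : T} {n : ℕ} (h : X.dist x z = n + 1) :
    ((X.neighborFinset z).filter (fun y => X.dist x y = n)).card = 1 := by
  obtain ⟨w, hw, hd⟩ := hX.connected.exists_adj_dist_eq h
  rw [Finset.card_eq_one]
  refine ⟨w, ?_⟩
  ext y
  rw [Finset.mem_filter, SimpleGraph.mem_neighborFinset, Finset.mem_singleton]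
  constructor
  · rintro ⟨h1, h2⟩
    exact hX.eq_of_adj_of_dist_eq h1.symm hw (by rw [h, h2]) (by rw [h, hd])
  · rintro rfl
    exact ⟨hw.symm, hd⟩

theorem card_neighbor_dist_succ {q : ℕ} (hX : X.IsTree) (hreg : X.IsRegularOfDegree (q + 1))
    {x z : T} {n : ℕ} (h : X.dist x z = n) :
    ((X.neighborFinset z).filter (fun y => X.dist x y = n + 1)).card =
      if n = 0 then q + 1 else q := by
  have hd := hreg z
  rw [← SimpleGraph.card_neighborFinset_eq_degree,
    ← Finset.card_filter_add_card_filter_not (fun y => X.dist x y = n + 1)] at hd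
  have hnot : (X.neighborFinset z).filter (fun y => ¬ X.dist x y = n + 1) =
      (X.neighborFinset z).filter (fun y => X.dist x y + 1 = n) := by
    refine Finset.filter_congr fun y hy => ?_
    rw [SimpleGraph.mem_neighborFinset] at hy
    have := hX.dist_eq_dist_add_one_of_adj x hy
    omega
  rw [hnot] at hd
  rcases n with _ | n
  · simp only [Nat.add_eq_zero_iff, one_ne_zero, and_false, Finset.filter_false,
      Finset.card_empty, add_zero] at hd
    simpa using hd
  · simp only [Nat.add_right_cancel_iff] at hd
    rw [card_neighbor_dist_pred hX h] at hd
    rw [if_neg (by omega)]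
    omega

theorem sum_sphere_one (hX : X.IsTree) (φ : T → ℂ) (x : T) :
    ∑ y ∈ sphere X x 1, φ y = adjFun X φ x := by
  unfold adjFun
  congr 1
  ext y
  rw [mem_sphere hX.connected, SimpleGraph.mem_neighborFinset, SimpleGraph.dist_eq_one_iff_adj]

/-- The product of the adjacency operator and a sphere operator. A vertex of the sphere of radius
`n + 2` has one neighbour in the sphere of radius `n + 1`; a vertex of the sphere of radius `n` has
`q` of them, or `q + 1` when it is the centre. -/
theorem sum_sphere_adjFun {q : ℕ} (hX : X.IsTree) (hreg : X.IsRegularOfDegree (q + 1))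
    (φ : T → ℂ) (x : T) (n : ℕ) :
    ∑ y ∈ sphere X x (n + 1), adjFun X φ y = ∑ y ∈ sphere X x (n + 2), φ y
      + (if n = 0 then (q : ℂ) + 1 else q) * ∑ y ∈ sphere X x n, φ y := by
  classical
  have hc := hX.connected
  have hswap : ∑ y ∈ sphere X x (n + 1), adjFun X φ y =
      ∑ z ∈ sphere X x (n + 2) ∪ sphere X x n,
        ∑ y ∈ (X.neighborFinset z).filter (fun y => X.dist x y = n + 1), φ z := by
    unfold adjFun
    refine Finset.sum_comm' fun y z => ?_
    simp only [Finset.mem_union, Finset.mem_filter, SimpleGraph.mem_neighborFinset,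
      mem_sphere hc]
    constructor
    · rintro ⟨h1, h2⟩
      have := hX.dist_eq_dist_add_one_of_adj x h2
      exact ⟨⟨h2.symm, h1⟩, by omega⟩
    · rintro ⟨⟨h1, h2⟩, -⟩
      exact ⟨h2, h1.symm⟩
  have hdisj : Disjoint (sphere X x (n + 2)) (sphere X x n) := by
    rw [Finset.disjoint_left]
    intro z h1 h2
    rw [mem_sphere hc] at h1 h2
    omega
  rw [hswap, Finset.sum_union hdisj, Finset.mul_sum]
  congr 1
  · refine Finset.sum_congr rfl fun z hz => ?_
    rw [Finset.sum_const, card_neighbor_dist_pred hX ((mem_sphere hc).1 hz), one_smul]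
  · refine Finset.sum_congr rfl fun z hz => ?_
    rw [Finset.sum_const, card_neighbor_dist_succ hX hreg ((mem_sphere hc).1 hz), nsmul_eq_mul]
    split_ifs <;> push_cast <;> rfl

/-- The value at `t` of the polynomial expressing the sum over a sphere of radius `n` of the
`(q+1)`-regular tree in terms of the adjacency operator. -/
def sphereEval {R : Type*} [CommRing R] (q : ℕ) (t : R) : ℕ → R
  | 0 => 1
  | 1 => t
  | 2 => t ^ 2 - (q + 1)
  | n + 3 => t * sphereEval q t (n + 2) - q * sphereEval q t (n + 1)

theorem sphereEval_succ_succ {R : Type*} [CommRing R] (q : ℕ) (t : R) (n : ℕ) :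
    sphereEval q t (n + 2) = t * sphereEval q t (n + 1)
      - (if n = 0 then (q : R) + 1 else q) * sphereEval q t n := by
  rcases n with _ | n
  · simp [sphereEval]
    ring
  · rw [if_neg (by omega)]
    rfl

theorem sphereEval_ofReal (q : ℕ) (t : ℝ) (n : ℕ) :
    sphereEval q (t : ℂ) n = (sphereEval q t n : ℝ) := by
  induction n using Nat.twoStepInduction with
  | zero => simp [sphereEval]
  | one => simp [sphereEval]
  | more n h1 h2 =>
    rw [sphereEval_succ_succ, sphereEval_succ_succ, h1, h2]
    split_ifs <;> push_cast <;> rfl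

/-- Eigenfunctions of the adjacency operator of a regular tree satisfy a mean value property. -/
theorem sum_sphere_of_eigen {q : ℕ} (hX : X.IsTree) (hreg : X.IsRegularOfDegree (q + 1))
    {φ : T → ℂ} {t : ℂ} (hφ : ∀ y, adjFun X φ y = t * φ y) (x : T) (n : ℕ) :
    ∑ y ∈ sphere X x n, φ y = sphereEval q t n * φ x := by
  induction n using Nat.twoStepInduction with
  | zero => simp [sphereEval, sphere]
  | one => rw [sum_sphere_one hX, hφ]; rfl
  | more n h1 h2 =>
    have h := sum_sphere_adjFun hX hreg φ x n
    simp only [hφ, ← Finset.mul_sum] at h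
    rw [h1, h2] at h
    rw [sphereEval_succ_succ]
    linear_combination -h

theorem card_sphere {q : ℕ} (hX : X.IsTree) (hreg : X.IsRegularOfDegree (q + 1)) (x : T) (n : ℕ) :
    ((sphere X x n).card : ℝ) = sphereEval q ((q : ℝ) + 1) n := by
  have h := sum_sphere_of_eigen hX hreg (φ := fun _ => 1) (t := (((q : ℝ) + 1 : ℝ) : ℂ))
    (fun y => by
      unfold adjFun
      rw [Finset.sum_const, SimpleGraph.card_neighborFinset_eq_degree, hreg y]
      simp) x n
  rw [Finset.sum_const, sphereEval_ofReal] at h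
  rw [nsmul_eq_mul, mul_one, mul_one] at h
  exact_mod_cast h

end QuantumErgodicity

/-! ### Tree balls of the quotient graph lift injectively -/

namespace QuantumErgodicity

variable {T : Type*} {X : SimpleGraph T} {Γ : Subgroup (X ≃g X)}

theorem edist_proj_le {x y : T} (p : X.Walk x y) :
    (underlying X Γ).edist (proj X Γ x) (proj X Γ y) ≤ p.length := by
  induction p with
  | nil => simp
  | @cons u v w h p ih =>
    refine (SimpleGraph.edist_triangle (v := proj X Γ v)).trans ?_
    have h1 : (underlying X Γ).edist (proj X Γ u) (proj X Γ v) ≤ 1 := by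
      rw [SimpleGraph.edist_le_one_iff_adj_or_eq]
      by_cases huv : proj X Γ u = proj X Γ v
      · exact Or.inr huv
      · exact Or.inl ⟨huv, Quotient.mk _ ⟨(u, v), h⟩, rfl, rfl⟩
    refine (add_le_add h1 ih).trans_eq ?_
    rw [SimpleGraph.Walk.length_cons, Nat.cast_add, Nat.cast_one, add_comm]

theorem proj_mem_ball (hX : X.Connected) {x y : T} {r : ℕ} (h : X.dist x y ≤ r) :
    proj X Γ y ∈ ball X Γ (proj X Γ x) r := by
  obtain ⟨p, hp⟩ := hX.exists_walk_length_eq_dist x y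
  exact (edist_proj_le p).trans (by rw [hp]; exact_mod_cast h)

/-- Where the quotient graph has no multiple edges, the covering map is injective on the
neighbours of a vertex. -/
theorem eq_of_adj_of_proj_eq (hfree : ActsFreely X Γ) {v : Vert X Γ} {r : ℕ}
    (hb : BallIsTree X Γ v r) {w y y' : T} (hw : proj X Γ w ∈ ball X Γ v r)
    (hy : proj X Γ y ∈ ball X Γ v r) (h : X.Adj w y) (h' : X.Adj w y')
    (heq : proj X Γ y = proj X Γ y') : y = y' := by
  have := hb.2.1 (Quotient.mk _ ⟨(w, y), h⟩) (Quotient.mk _ ⟨(w, y'), h'⟩) hw hy rfl heq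
  rw [Quotient.eq, MulAction.orbitRel_apply] at this
  obtain ⟨g, hg⟩ := this
  have hgw : g.1 w = w := congrArg (fun d : X.Dart => d.fst) hg
  have hgy : g.1 y' = y := congrArg (fun d : X.Dart => d.snd) hg
  have h1 := hfree g.1 g.2 w hgw
  rw [h1] at hgy
  exact hgy.symm

theorem induce_adj_of_adj {v : Vert X Γ} {r : ℕ}
    (hb : BallIsTree X Γ v r) {w y : T} (hw : proj X Γ w ∈ ball X Γ v r)
    (hy : proj X Γ y ∈ ball X Γ v r) (h : X.Adj w y) :
    ((underlying X Γ).induce (ball X Γ v r)).Adj ⟨proj X Γ w, hw⟩ ⟨proj X Γ y, hy⟩ :=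
  ⟨hb.1 (Quotient.mk _ ⟨(w, y), h⟩) hw hy, Quotient.mk _ ⟨(w, y), h⟩, rfl, rfl⟩

/-- The covering map preserves distances to the centre of a tree ball: a step of a geodesic cannot
lead back to the parent, by freeness of the action and the absence of multiple edges. -/
theorem dist_proj_eq (hX : X.IsTree) (hfree : ActsFreely X Γ) {x : T} {r : ℕ}
    (hb : BallIsTree X Γ (proj X Γ x) r) (n : ℕ) :
    ∀ (y : T) (_ : X.dist x y = n) (hr : X.dist x y ≤ r),
    ((underlying X Γ).induce (ball X Γ (proj X Γ x) r)).dist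
      ⟨proj X Γ x, proj_mem_ball hX.connected (by simp)⟩
      ⟨proj X Γ y, proj_mem_ball hX.connected hr⟩ = n := by
  have hc := hX.connected
  induction n using Nat.twoStepInduction with
  | zero =>
    intro y hn hr
    rw [hc.dist_eq_zero_iff] at hn
    subst hn
    simp
  | one =>
    intro y hn hr
    rw [SimpleGraph.dist_eq_one_iff_adj] at hn ⊢
    exact induce_adj_of_adj hb _ _ hn
  | more n h0 h1 =>
    intro y hn hr
    obtain ⟨w, hw, hdw⟩ := hc.exists_adj_dist_eq hn
    obtain ⟨u, hu, hdu⟩ := hc.exists_adj_dist_eq hdw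
    have hwr : X.dist x w ≤ r := by omega
    have hur : X.dist x u ≤ r := by omega
    have hyb := proj_mem_ball (Γ := Γ) hc hr
    have hwb := proj_mem_ball (Γ := Γ) hc hwr
    have hub := proj_mem_ball (Γ := Γ) hc hur
    have e1 := h1 w hdw hwr
    have e0 := h0 u hdu hur
    have a1 := induce_adj_of_adj hb hwb hyb hw
    have a0 := induce_adj_of_adj hb hwb hub hu.symm
    rcases hb.2.2.dist_eq_dist_add_one_of_adj ⟨proj X Γ x, proj_mem_ball hc (by simp)⟩ a1 with h | h
    · exfalso
      have hyu := hb.2.2.eq_of_adj_of_dist_eq a1.symm a0.symm h (by rw [e1, e0])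
      have := eq_of_adj_of_proj_eq hfree hb hwb hyb hw hu.symm (congrArg Subtype.val hyu)
      rw [this] at hn
      omega
    · rw [h, e1]

theorem proj_injOn_of_ballIsTree (hX : X.IsTree) (hfree : ActsFreely X Γ) {x : T} {r : ℕ}
    (hb : BallIsTree X Γ (proj X Γ x) r) {y y' : T} (hy : X.dist x y ≤ r) (hy' : X.dist x y' ≤ r)
    (h : proj X Γ y = proj X Γ y') : y = y' := by
  have hc := hX.connected
  obtain ⟨n, hn⟩ : ∃ n, X.dist x y = n := ⟨_, rfl⟩
  induction n generalizing y y' with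
  | zero =>
    have e := dist_proj_eq hX hfree hb _ y hn hy
    have e' := dist_proj_eq hX hfree hb _ y' rfl hy'
    simp only [h] at e
    rw [e] at e'
    rw [hc.dist_eq_zero_iff] at hn
    rw [eq_comm, hc.dist_eq_zero_iff] at e'
    rw [← hn, e']
  | succ n ih =>
    have e := dist_proj_eq hX hfree hb _ y hn hy
    have e' := dist_proj_eq hX hfree hb _ y' rfl hy'
    simp only [h] at e
    rw [e] at e'
    obtain ⟨w, hw, hdw⟩ := hc.exists_adj_dist_eq hn
    obtain ⟨w', hw', hdw'⟩ := hc.exists_adj_dist_eq e'.symm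
    have hwr : X.dist x w ≤ r := by omega
    have hwr' : X.dist x w' ≤ r := by omega
    have hyb' := proj_mem_ball (Γ := Γ) hc hy'
    have hyb := proj_mem_ball (Γ := Γ) hc hy
    have hwb := proj_mem_ball (Γ := Γ) hc hwr
    have hwb' := proj_mem_ball (Γ := Γ) hc hwr'
    have a := induce_adj_of_adj hb hwb hyb hw
    have a' := induce_adj_of_adj hb hwb' hyb' hw'
    simp only [h] at a
    have hww := hb.2.2.eq_of_adj_of_dist_eq a a'
      (by rw [e, dist_proj_eq hX hfree hb _ w hdw hwr])
      (by rw [e, dist_proj_eq hX hfree hb _ w' hdw' hwr'])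
    have := ih hwr hwr' (congrArg Subtype.val hww) hdw
    subst this
    exact eq_of_adj_of_proj_eq hfree hb hwb hyb hw hw' h

theorem exists_ballIsTree_of_le_injRadius {v : Vert X Γ} {R : ℕ} (hR : 0 < R)
    (h : (R : ℕ∞) ≤ injRadius X Γ v) : ∃ r, R ≤ r ∧ BallIsTree X Γ v r := by
  by_contra! hcon
  have : injRadius X Γ v ≤ ((R - 1 : ℕ) : ℕ∞) := by
    refine iSup₂_le fun r hr => ?_
    have : r < R := by
      by_contra! hlt
      exact hcon r hlt hr
    exact_mod_cast Nat.le_sub_one_of_lt this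
  have h2 := h.trans this
  rw [Nat.cast_le] at h2
  omega

/-- Balls of radius at most the injectivity radius lift injectively. -/
theorem proj_injOn_of_le_injRadius (hX : X.IsTree) (hfree : ActsFreely X Γ) {x : T} {R : ℕ}
    (hR : 0 < R) (h : (R : ℕ∞) ≤ injRadius X Γ (proj X Γ x)) {y y' : T} (hy : X.dist x y ≤ R)
    (hy' : X.dist x y' ≤ R) (hyy : proj X Γ y = proj X Γ y') : y = y' := by
  obtain ⟨r, hr, hb⟩ := exists_ballIsTree_of_le_injRadius hR h
  exact proj_injOn_of_ballIsTree hX hfree hb (hy.trans hr) (hy'.trans hr) hyy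

end QuantumErgodicity

namespace QuantumErgodicity

/-! ### Decay of spherical functions away from the trivial eigenvalue -/

/-- The quadratic form `x (n + 1) ^ 2 + x n ^ 2 - 2 * κ * x (n + 1) * x n` decreases along the
recurrence and is coercive for `|κ| < 1`. -/
theorem sq_le_of_recurrence {x : ℕ → ℝ} {p κ β : ℝ} (hp0 : 0 ≤ p) (hp1 : p ≤ 1) (hβ : 0 < β)
    (hκ : |κ| ≤ 1 - β) (hx : ∀ n, x (n + 2) = (1 + p) * κ * x (n + 1) - p * x n) (n : ℕ) :
    x n ^ 2 ≤ 2 / β * (x 0 ^ 2 + x 1 ^ 2) := by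
  have hV : ∀ n, x (n + 1) ^ 2 + x n ^ 2 - 2 * κ * x (n + 1) * x n ≤
      x 1 ^ 2 + x 0 ^ 2 - 2 * κ * x 1 * x 0 := by
    intro n
    induction n with
    | zero => simp
    | succ n ih =>
      refine le_trans ?_ ih
      have h := hx n
      have hfac : (1 + p) * ((x (n + 2) ^ 2 + x (n + 1) ^ 2 - 2 * κ * x (n + 2) * x (n + 1)) -
          (x (n + 1) ^ 2 + x n ^ 2 - 2 * κ * x (n + 1) * x n)) =
          -((1 - p) * (x (n + 2) - x n) ^ 2) := by
        linear_combination (2 * (x (n + 2) - x n)) * h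
      have hneg : 0 ≤ (1 - p) * (x (n + 2) - x n) ^ 2 :=
        mul_nonneg (by linarith) (sq_nonneg _)
      by_contra! hcon
      have := mul_pos (show (0 : ℝ) < 1 + p by linarith) (sub_pos.2 hcon)
      linarith
  have hcross : ∀ a b : ℝ, |2 * κ * a * b| ≤ (1 - β) * (a ^ 2 + b ^ 2) := by
    intro a b
    have h1 : |2 * κ * a * b| = |κ| * (2 * |a| * |b|) := by
      simp only [abs_mul, abs_two]
      ring
    rw [h1, ← sq_abs a, ← sq_abs b]
    have h2 := sq_nonneg (|a| - |b|)
    exact mul_le_mul hκ (by linarith) (by positivity) ((abs_nonneg κ).trans hκ)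
  have hβ1 : 0 ≤ 1 - β := (abs_nonneg κ).trans hκ
  have hn := hV n
  have h1 := (abs_le.1 (hcross (x (n + 1)) (x n))).2
  have h2 := (abs_le.1 (hcross (x 1) (x 0))).1
  rw [div_mul_eq_mul_div, le_div_iff₀ hβ]
  nlinarith [sq_nonneg (x (n + 1)), sq_nonneg (x 0), sq_nonneg (x 1)]

theorem abs_sphereEval_le {q : ℕ} {r β : ℝ} (hr : 0 < r) (hqr : (q : ℝ) ≤ r ^ 2) (hβ : 0 < β) :
    ∃ C : ℝ, 0 < C ∧ ∀ t : ℝ, |t| ≤ q + 1 → |t| ≤ (r + q / r) * (1 - β) →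
      ∀ n, |sphereEval q t n| ≤ C * r ^ n := by
  set M : ℝ := 2 / β * (((q + 1) / r) ^ 2 + (((q + 1 : ℝ) ^ 2 + (q + 1)) / r ^ 2) ^ 2) with hM
  have hM0 : 0 < M := by positivity
  refine ⟨1 + Real.sqrt M, by positivity, fun t ht ht' n => ?_⟩
  rcases n with _ | n
  · simp only [sphereEval, abs_one, pow_zero, mul_one]
    linarith [Real.sqrt_nonneg M]
  have hpos : 0 < r + q / r := by positivity
  have hκ : |t / (r + q / r)| ≤ 1 - β := by
    rw [abs_div, abs_of_pos hpos, div_le_iff₀ hpos]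
    linarith
  have hp1 : (q : ℝ) / r ^ 2 ≤ 1 := by
    rw [div_le_one (by positivity)]
    exact hqr
  have key := sq_le_of_recurrence (x := fun n => sphereEval q t (n + 1) / r ^ (n + 1))
    (p := q / r ^ 2) (by positivity) hp1 hβ hκ (fun n => by
      simp only [sphereEval]
      field_simp
      ring) n
  have hb0 : (sphereEval q t (0 + 1) / r ^ (0 + 1)) ^ 2 ≤ ((q + 1) / r) ^ 2 := by
    apply sq_le_sq'
    · have := neg_le_of_abs_le ht
      simp only [sphereEval, zero_add, pow_one]
      rw [neg_le_iff_add_nonneg, ← add_div]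
      apply div_nonneg _ hr.le
      linarith
    · simp only [sphereEval, zero_add, pow_one]
      gcongr
      exact le_of_abs_le ht
  have hb1 : (sphereEval q t (1 + 1) / r ^ (1 + 1)) ^ 2 ≤
      (((q + 1 : ℝ) ^ 2 + (q + 1)) / r ^ 2) ^ 2 := by
    simp only [sphereEval, Nat.reduceAdd]
    have ht2 : t ^ 2 ≤ ((q : ℝ) + 1) ^ 2 := by
      rw [← sq_abs t]
      gcongr
    rw [← sq_abs, abs_div, abs_of_pos (show 0 < r ^ 2 by positivity)]
    gcongr
    rw [abs_le]
    constructor <;> nlinarith [sq_nonneg t]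
  have hfin : (sphereEval q t (n + 1) / r ^ (n + 1)) ^ 2 ≤ M := by
    refine key.trans ?_
    rw [hM]
    gcongr
  have := Real.abs_le_sqrt hfin
  rw [abs_div, abs_of_pos (show 0 < r ^ (n + 1) by positivity), div_le_iff₀ (by positivity)] at this
  refine this.trans ?_
  gcongr
  linarith

/-- For `q ≥ 2`, the sphere operators decay exponentially, relative to the size of the spheres, on
the part of the spectrum separated from `±(q + 1)`. -/
theorem exists_abs_sphereEval_le {q : ℕ} (hq : 2 ≤ q) {β : ℝ} (hβ : 0 < β) :
    ∃ r C : ℝ, 1 < r ∧ r < q ∧ 0 < C ∧ ∀ t : ℝ, |t| ≤ (q + 1) * (1 - β) →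
      ∀ n, |sphereEval q t n| ≤ C * r ^ n := by
  have hq' : (2 : ℝ) ≤ q := by exact_mod_cast hq
  -- `r = q * (1 - ε)` works: `r + q / r` is close to `q + 1`, and `q ≤ r ^ 2` for `ε ≤ 1 / 4`.
  set ε : ℝ := min (β / 2) (1 / 4) with hε
  have hε0 : 0 < ε := by positivity
  have hε1 : ε ≤ 1 / 4 := min_le_right _ _
  have hε2 : 2 * ε ≤ β := by linarith [min_le_left (β / 2) (1 / 4 : ℝ)]
  have hr : 0 < q * (1 - ε) := by nlinarith
  have hr1 : 1 < q * (1 - ε) := by nlinarith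
  have hqr : (q : ℝ) ≤ (q * (1 - ε)) ^ 2 := by
    have h1 : (9 : ℝ) / 16 ≤ (1 - ε) ^ 2 := by nlinarith
    have h2 : (2 : ℝ) * q ≤ q ^ 2 := by nlinarith
    rw [mul_pow]
    nlinarith
  obtain ⟨C, hC, h⟩ := abs_sphereEval_le hr hqr hε0
  refine ⟨q * (1 - ε), C, hr1, by nlinarith, hC, fun t ht n => h t ?_ ?_ n⟩
  · refine ht.trans ?_
    nlinarith
  · refine ht.trans ?_
    have h1 : 1 ≤ q / (q * (1 - ε)) := by
      rw [le_div_iff₀ hr]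
      nlinarith
    calc (q + 1) * (1 - β) ≤ (q + 1) * (1 - 2 * ε) := by gcongr
      _ ≤ (q * (1 - ε) + 1) * (1 - ε) := by nlinarith [sq_nonneg ε]
      _ ≤ _ := by gcongr; linarith

/-! ### Chebyshev polynomials -/

/-- The value at `t` of the `n`-th Dickson polynomial with parameter `q`. It is
`2 * q ^ (n / 2)` times the Chebyshev polynomial of the first kind at `t / (2 * √q)`. -/
def dickson (q : ℕ) (t : ℝ) : ℕ → ℝ
  | 0 => 2
  | 1 => t
  | n + 2 => t * dickson q t (n + 1) - q * dickson q t n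

theorem dickson_mul_dickson (q : ℕ) (t : ℝ) (m : ℕ) : ∀ k, dickson q t m * dickson q t (m + k) =
    dickson q t (2 * m + k) + q ^ m * dickson q t k := by
  induction m using Nat.twoStepInduction with
  | zero => intro k; simp [dickson]; ring
  | one =>
    intro k
    rw [show 1 + k = k + 1 by ring, show 2 * 1 + k = k + 2 by ring]
    simp only [dickson]
    ring
  | more m h0 h1 =>
    intro k
    have e1 := h1 (k + 1)
    have e0 := h0 (k + 2)
    rw [show m + 1 + (k + 1) = m + 2 + k by ring,
      show 2 * (m + 1) + (k + 1) = 2 * m + k + 3 by ring] at e1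
    rw [show m + (k + 2) = m + 2 + k by ring, show 2 * m + (k + 2) = 2 * m + k + 2 by ring] at e0
    rw [show 2 * (m + 2) + k = 2 * m + k + 2 + 2 by ring]
    have d1 : dickson q t (m + 2) = t * dickson q t (m + 1) - q * dickson q t m := rfl
    have d2 : dickson q t (2 * m + k + 2 + 2) =
      t * dickson q t (2 * m + k + 3) - q * dickson q t (2 * m + k + 2) := rfl
    have d3 : dickson q t (k + 2) = t * dickson q t (k + 1) - q * dickson q t k := rfl
    rw [d1, d2]
    rw [d3] at e0
    linear_combination t * e1 - q * e0

theorem dickson_add_two (q : ℕ) (t : ℝ) (n : ℕ) : dickson q t (n + 2) = dickson q t n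
    + sphereEval q t (n + 2) - (if n = 0 then (q : ℝ) + 1 else q) * sphereEval q t n := by
  induction n using Nat.twoStepInduction with
  | zero => simp [dickson, sphereEval]; ring
  | one => simp [dickson, sphereEval]; ring
  | more n h0 h1 =>
    have d1 : dickson q t (n + 2 + 2) = t * dickson q t (n + 1 + 2) - q * dickson q t (n + 2) := rfl
    have d2 : dickson q t (n + 2) = t * dickson q t (n + 1) - q * dickson q t n := rfl
    have s1 := sphereEval_succ_succ q t n
    have s2 : sphereEval q t (n + 2 + 2) =
      t * sphereEval q t (n + 1 + 2) - q * sphereEval q t (n + 2) := rfl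
    rw [if_neg (by omega)] at h1 ⊢
    linear_combination d1 - s2 + t * h1 - q * h0 - d2 + q * s1

/-- The Chebyshev polynomials are combinations of sphere polynomials with bounded coefficients:
their kernels on the tree are bounded, apart from the normalization, uniformly in the degree. -/
theorem exists_dickson_eq_sum (q : ℕ) (n : ℕ) : ∃ c : ℕ → ℝ, (∀ d, |c d| ≤ q + 2) ∧
    (c n = if n = 0 then 2 else 1) ∧
    ∀ t, dickson q t n = ∑ d ∈ Finset.range (n + 1), c d * sphereEval q t d := by
  have hq : (0 : ℝ) ≤ q := Nat.cast_nonneg q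
  induction n using Nat.twoStepInduction with
  | zero =>
    refine ⟨fun _ => 2, fun _ => ?_, by simp, fun t => by simp [dickson, sphereEval]⟩
    rw [abs_two]
    linarith
  | one =>
    refine ⟨fun d => if d = 1 then 1 else 0, fun d => ?_, by simp,
      fun t => by simp [dickson, sphereEval]⟩
    dsimp only
    split_ifs <;> simp <;> linarith
  | more n h0 _ =>
    obtain ⟨c, hc, hcn, h⟩ := h0
    refine ⟨fun d => if d = n + 2 then 1 else if d = n then 1 - q else if d = n + 1 then 0 else c d,
      fun d => ?_, by simp, fun t => ?_⟩
    · simp only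
      split_ifs
      · simp only [abs_one]; linarith
      · rw [abs_le]; constructor <;> linarith
      · simp only [abs_zero]; linarith
      · exact hc d
    · rw [dickson_add_two, h, Finset.sum_range_succ, Finset.sum_range_succ,
        Finset.sum_range_succ, Finset.sum_range_succ]
      have hs : ∑ d ∈ Finset.range n, (if d = n + 2 then 1 else if d = n then 1 - (q : ℝ)
          else if d = n + 1 then 0 else c d) * sphereEval q t d
          = ∑ d ∈ Finset.range n, c d * sphereEval q t d := by
        refine Finset.sum_congr rfl fun d hd => ?_
        rw [Finset.mem_range] at hd
        rw [if_neg (by omega), if_neg (by omega), if_neg (by omega)]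
      rw [hs, hcn]
      simp only [if_true, if_neg (show n ≠ n + 2 by omega), if_neg (show n + 1 ≠ n + 2 by omega),
        if_neg (show n + 1 ≠ n by omega)]
      split_ifs <;> ring

/-- Cesàro averages of the squared Chebyshev polynomials are bounded below on the real line, by the
duplication formula. -/
theorem le_sum_dickson_sq {q : ℕ} (hq : 0 < q) (t : ℝ) (M : ℕ) :
    7 / 8 * (M : ℝ) ≤ ∑ n ∈ Finset.range (2 * M), dickson q t n ^ 2 / q ^ n := by
  have hq' : (0 : ℝ) < q := by exact_mod_cast hq
  set w : ℕ → ℝ := fun n => dickson q t n ^ 2 / q ^ n with hw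
  have hw0 : ∀ n, 0 ≤ w n := fun n => by positivity
  have hdup : ∀ n, w (2 * n) = (w n - 2) ^ 2 := by
    intro n
    have h := dickson_mul_dickson q t n 0
    simp only [add_zero, dickson] at h
    have h2 : dickson q t (2 * n) = dickson q t n ^ 2 - q ^ n * 2 := by linarith
    simp only [hw]
    rw [h2]
    field_simp
    ring
  have h1 : ∑ n ∈ Finset.range M, w n ≤ ∑ n ∈ Finset.range (2 * M), w n :=
    Finset.sum_le_sum_of_subset_of_nonneg
      (Finset.range_subset_range.2 (by omega)) (fun n _ _ => hw0 n)
  have h2 : ∑ n ∈ Finset.range M, w (2 * n) ≤ ∑ n ∈ Finset.range (2 * M), w n := by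
    rw [← Finset.sum_image (f := w) (g := fun n => 2 * n) (fun a _ b _ hab => by simpa using hab)]
    refine Finset.sum_le_sum_of_subset_of_nonneg ?_ (fun n _ _ => hw0 n)
    intro k hk
    rw [Finset.mem_image] at hk
    obtain ⟨n, hn, rfl⟩ := hk
    rw [Finset.mem_range] at hn ⊢
    omega
  have h3 : (M : ℝ) * (7 / 4) ≤ ∑ n ∈ Finset.range M, (w n + w (2 * n)) := by
    rw [← nsmul_eq_mul, ← Finset.card_range M, ← Finset.sum_const, Finset.card_range]
    refine Finset.sum_le_sum fun n _ => ?_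
    rw [hdup]
    nlinarith [sq_nonneg (w n - 3 / 2)]
  rw [Finset.sum_add_distrib] at h3
  linarith

/-! ### Time averages -/

theorem sum_pow_le_of_injOn {σ : ℝ} (h0 : 0 ≤ σ) (h1 : σ < 1) (s : Finset ℕ) (f : ℕ → ℕ)
    (hf : Set.InjOn f s) : ∑ m ∈ s, σ ^ f m ≤ (1 - σ)⁻¹ := by
  rw [← Finset.sum_image (f := fun k => σ ^ k) hf, ← tsum_geometric_of_lt_one h0 h1]
  exact (summable_geometric_of_lt_one h0 h1).sum_le_tsum _ (fun _ _ => by positivity)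

theorem sum_pow_dist_le {σ : ℝ} (h0 : 0 ≤ σ) (h1 : σ < 1) (n M : ℕ) :
    ∑ m ∈ Finset.range M, σ ^ (n.dist m) ≤ 2 * (1 - σ)⁻¹ := by
  rw [← Finset.sum_filter_add_sum_filter_not _ (fun m => m ≤ n), two_mul]
  refine add_le_add (sum_pow_le_of_injOn h0 h1 _ _ ?_) (sum_pow_le_of_injOn h0 h1 _ _ ?_)
  all_goals
    intro a ha b hb hab
    simp only [Finset.coe_filter, Set.mem_ofPred_eq] at ha hb
    simp only [Nat.dist] at hab
    omega

/-- If the double sums of `g` against pairs of Chebyshev polynomials decay with the smaller degree,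
then the diagonal of `g` is small. By the product formula, the Cesàro average of
`g i j * (D_n D_m) (x i) * (D_n D_m) (x j)` concentrates near `n = m`. -/
theorem sum_diag_le {ι : Type*} [Fintype ι] {q : ℕ} {r A B : ℝ} (hr : 1 < r)
    (hrq : r < q) (x : ι → ℝ) (g : ι → ι → ℝ) (hg : ∀ i j, 0 ≤ g i j) (hA : 0 ≤ A) (hB : 0 ≤ B)
    (M : ℕ) (h : ∀ k l, k ≤ 4 * M → l ≤ 4 * M →
      |∑ i, ∑ j, g i j * (dickson q (x i) k * dickson q (x j) l)| ≤ A * r ^ (min k l) + B) :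
    (7 / 8 * M) ^ 2 * ∑ j, g j j ≤ 16 * A * (1 - r / q)⁻¹ * M + 16 * B * M ^ 2 := by
  have hq : (1 : ℝ) < q := hr.trans hrq
  have hqn : 0 < q := by exact_mod_cast (zero_lt_one.trans hq)
  have hq0 : (0 : ℝ) < q := by exact_mod_cast hqn
  set σ : ℝ := r / q with hσ
  have hσ0 : 0 ≤ σ := by positivity
  have hσ1 : σ < 1 := by rw [hσ, div_lt_one hq0]; exact hrq
  set F : ℕ → ℕ → ℝ := fun k l => ∑ i, ∑ j, g i j * (dickson q (x i) k * dickson q (x j) l) with hF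
  set G : ℕ → ℕ → ℝ := fun n m => (q : ℝ)⁻¹ ^ n * (q : ℝ)⁻¹ ^ m *
    ∑ i, ∑ j, g i j * ((dickson q (x i) n * dickson q (x i) m) *
      (dickson q (x j) n * dickson q (x j) m)) with hG
  have hGsymm : ∀ n m, G n m = G m n := by
    intro n m
    simp only [hG]
    rw [mul_comm ((q : ℝ)⁻¹ ^ n)]
    congr 1
    refine Finset.sum_congr rfl fun i _ => Finset.sum_congr rfl fun j _ => ?_
    ring
  have hGadd : ∀ m k, m + k < 2 * M → G m (m + k) ≤ 4 * A * σ ^ k + 4 * B := by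
    intro m k hmk
    have hexp : G m (m + k) = (q : ℝ)⁻¹ ^ (2 * m + k) * F (2 * m + k) (2 * m + k)
        + (q : ℝ)⁻¹ ^ (m + k) * F (2 * m + k) k + (q : ℝ)⁻¹ ^ (m + k) * F k (2 * m + k)
        + (q : ℝ)⁻¹ ^ k * F k k := by
      simp only [hG, hF, Finset.mul_sum, ← Finset.sum_add_distrib]
      refine Finset.sum_congr rfl fun i _ => Finset.sum_congr rfl fun j _ => ?_
      rw [dickson_mul_dickson, dickson_mul_dickson]
      have hqm : (q : ℝ)⁻¹ ^ m * q ^ m = 1 := by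
        rw [← mul_pow, inv_mul_cancel₀ hq0.ne', one_pow]
      have e1 : (q : ℝ)⁻¹ ^ (m + k) = (q : ℝ)⁻¹ ^ m * (q : ℝ)⁻¹ ^ k := pow_add _ _ _
      have e2 : (q : ℝ)⁻¹ ^ (2 * m + k) = (q : ℝ)⁻¹ ^ m * ((q : ℝ)⁻¹ ^ m * (q : ℝ)⁻¹ ^ k) := by
        ring
      rw [e1, e2]
      linear_combination ((q : ℝ)⁻¹ ^ m * (q : ℝ)⁻¹ ^ k * g i j
          * (dickson q (x i) (2 * m + k) * dickson q (x j) k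
            + dickson q (x i) k * dickson q (x j) (2 * m + k))
        + (q : ℝ)⁻¹ ^ k * g i j * dickson q (x i) k * dickson q (x j) k
            * ((q : ℝ)⁻¹ ^ m * q ^ m + 1)) * hqm
    have hqi0 : (0 : ℝ) ≤ (q : ℝ)⁻¹ := by positivity
    have hqi1 : (q : ℝ)⁻¹ ≤ 1 := inv_le_one_of_one_le₀ hq.le
    -- Each of the four terms has a weight `q⁻¹ ^ a` with `a` at least the smaller degree.
    have hterm : ∀ a k' l', k' ≤ 4 * M → l' ≤ 4 * M → min k' l' ≤ a → k ≤ min k' l' →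
        (q : ℝ)⁻¹ ^ a * F k' l' ≤ A * σ ^ k + B := by
      intro a k' l' hk' hl' ha hk
      have hpa : (q : ℝ)⁻¹ ^ a ≤ (q : ℝ)⁻¹ ^ (min k' l') := pow_le_pow_of_le_one hqi0 hqi1 ha
      calc (q : ℝ)⁻¹ ^ a * F k' l' ≤ (q : ℝ)⁻¹ ^ a * (A * r ^ (min k' l') + B) := by
            gcongr
            exact (le_abs_self _).trans (h k' l' hk' hl')
        _ = A * ((q : ℝ)⁻¹ ^ a * r ^ (min k' l')) + (q : ℝ)⁻¹ ^ a * B := by ring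
        _ ≤ A * ((q : ℝ)⁻¹ ^ (min k' l') * r ^ (min k' l')) + 1 * B := by
            gcongr
            exact pow_le_one₀ hqi0 hqi1
        _ = A * σ ^ (min k' l') + B := by
            rw [← mul_pow, hσ, one_mul, inv_mul_eq_div]
        _ ≤ A * σ ^ k + B := by
            gcongr A * ?_ + B
            exact pow_le_pow_of_le_one hσ0 hσ1.le hk
    rw [hexp]
    have t1 := hterm (2 * m + k) (2 * m + k) (2 * m + k) (by omega) (by omega) (by omega) (by omega)
    have t2 := hterm (m + k) (2 * m + k) k (by omega) (by omega) (by omega) (by omega)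
    have t3 := hterm (m + k) k (2 * m + k) (by omega) (by omega) (by omega) (by omega)
    have t4 := hterm k k k (by omega) (by omega) (by omega) (by omega)
    linarith
  have hGle : ∀ n m, n < 2 * M → m < 2 * M → G n m ≤ 4 * A * σ ^ (n.dist m) + 4 * B := by
    intro n m hn hm
    rcases le_total n m with hnm | hnm
    · obtain ⟨k, rfl⟩ := Nat.exists_eq_add_of_le hnm
      rw [Nat.dist_eq_sub_of_le hnm, Nat.add_sub_cancel_left]
      exact hGadd n k hm
    · obtain ⟨k, rfl⟩ := Nat.exists_eq_add_of_le hnm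
      rw [Nat.dist_eq_sub_of_le_right hnm, Nat.add_sub_cancel_left, hGsymm]
      exact hGadd m k hn
  have hsum : ∑ n ∈ Finset.range (2 * M), ∑ m ∈ Finset.range (2 * M), G n m ≤
      16 * A * (1 - σ)⁻¹ * M + 16 * B * M ^ 2 := by
    calc _ ≤ ∑ n ∈ Finset.range (2 * M), ∑ m ∈ Finset.range (2 * M),
          (4 * A * σ ^ (n.dist m) + 4 * B) :=
          Finset.sum_le_sum fun n hn => Finset.sum_le_sum fun m hm =>
            hGle n m (Finset.mem_range.1 hn) (Finset.mem_range.1 hm)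
      _ ≤ ∑ n ∈ Finset.range (2 * M), (4 * A * (2 * (1 - σ)⁻¹) + (2 * M : ℕ) * (4 * B)) := by
          refine Finset.sum_le_sum fun n _ => ?_
          rw [Finset.sum_add_distrib, ← Finset.mul_sum, Finset.sum_const, Finset.card_range,
            nsmul_eq_mul]
          gcongr
          exact sum_pow_dist_le hσ0 hσ1 n _
      _ = _ := by
          rw [Finset.sum_const, Finset.card_range, nsmul_eq_mul]
          push_cast
          ring
  have hsq : ∑ n ∈ Finset.range (2 * M), ∑ m ∈ Finset.range (2 * M), G n m =
      ∑ i, ∑ j, g i j *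
        (∑ n ∈ Finset.range (2 * M), (q : ℝ)⁻¹ ^ n * (dickson q (x i) n * dickson q (x j) n)) ^ 2 :=
    by
    have hR : ∀ i j, g i j * (∑ n ∈ Finset.range (2 * M),
        (q : ℝ)⁻¹ ^ n * (dickson q (x i) n * dickson q (x j) n)) ^ 2 =
        ∑ n ∈ Finset.range (2 * M), ∑ m ∈ Finset.range (2 * M), (q : ℝ)⁻¹ ^ n * (q : ℝ)⁻¹ ^ m *
          (g i j * ((dickson q (x i) n * dickson q (x i) m) *
            (dickson q (x j) n * dickson q (x j) m))) := by
      intro i j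
      rw [pow_two, Finset.sum_mul_sum, Finset.mul_sum]
      refine Finset.sum_congr rfl fun n _ => ?_
      rw [Finset.mul_sum]
      refine Finset.sum_congr rfl fun m _ => ?_
      ring
    simp only [hR]
    simp only [hG, Finset.mul_sum]
    have : ∀ i, ∑ j, ∑ n ∈ Finset.range (2 * M), ∑ m ∈ Finset.range (2 * M),
        (q : ℝ)⁻¹ ^ n * (q : ℝ)⁻¹ ^ m * (g i j * ((dickson q (x i) n * dickson q (x i) m) *
            (dickson q (x j) n * dickson q (x j) m))) =
        ∑ n ∈ Finset.range (2 * M), ∑ m ∈ Finset.range (2 * M), ∑ j,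
        (q : ℝ)⁻¹ ^ n * (q : ℝ)⁻¹ ^ m * (g i j * ((dickson q (x i) n * dickson q (x i) m) *
            (dickson q (x j) n * dickson q (x j) m))) := by
      intro i
      rw [Finset.sum_comm]
      exact Finset.sum_congr rfl fun n _ => Finset.sum_comm
    simp only [this]
    rw [Finset.sum_comm (s := Finset.univ)]
    exact Finset.sum_congr rfl fun n _ => Finset.sum_comm
  rw [hsq] at hsum
  refine le_trans ?_ hsum
  rw [Finset.mul_sum]
  refine Finset.sum_le_sum fun j _ => ?_
  refine le_trans ?_ (Finset.single_le_sum (f := fun j' => g j j' * (∑ n ∈ Finset.range (2 * M),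
        (q : ℝ)⁻¹ ^ n * (dickson q (x j) n * dickson q (x j') n)) ^ 2)
        (fun j' _ => mul_nonneg (hg _ _) (sq_nonneg _)) (Finset.mem_univ j))
  rw [mul_comm]
  refine mul_le_mul_of_nonneg_left ?_ (hg _ _)
  refine pow_le_pow_left₀ (by positivity) ?_ 2
  refine (le_sum_dickson_sq hqn (x j) M).trans (le_of_eq ?_)
  refine Finset.sum_congr rfl fun n _ => ?_
  rw [inv_pow]
  ring

end QuantumErgodicity

/-! ### Sphere kernels on the quotient and their spectral expansion -/

namespace QuantumErgodicity

section Basis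

variable {V ι : Type*} [Fintype V] [Fintype ι]

theorem sum_basis_mul_conj [DecidableEq V]
    (ψ : OrthonormalBasis ι ℂ (EuclideanSpace ℂ V)) (v w : V) :
    ∑ j, ψ j v * (starRingEnd ℂ) (ψ j w) = if v = w then 1 else 0 := by
  have h := ψ.sum_inner_mul_inner (EuclideanSpace.single v (1 : ℂ)) (EuclideanSpace.single w 1)
  simp only [EuclideanSpace.inner_single_left, EuclideanSpace.inner_single_right, map_one,
    one_mul] at h
  rw [h, PiLp.single_apply]
  simp only [eq_comm, apply_ite (starRingEnd ℂ), map_one, map_zero]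

/-- The matrix coefficients `⟨ψ i, b ψ j⟩` of the multiplication operator by `b`. -/
noncomputable def matrixCoeff (ψ : OrthonormalBasis ι ℂ (EuclideanSpace ℂ V)) (b : V → ℂ)
    (i j : ι) : ℂ :=
  inner ℂ (ψ i) (WithLp.toLp 2 (fun v => b v * ψ j v))

theorem matrixCoeff_eq_sum (ψ : OrthonormalBasis ι ℂ (EuclideanSpace ℂ V)) (b : V → ℂ) (i j : ι) :
    matrixCoeff ψ b i j = ∑ v, b v * (ψ j v * (starRingEnd ℂ) (ψ i v)) := by
  rw [matrixCoeff, PiLp.inner_apply]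
  refine Finset.sum_congr rfl fun v _ => ?_
  rw [RCLike.inner_apply]
  ring

theorem inner_toLp_eq_sum (ψ : OrthonormalBasis ι ℂ (EuclideanSpace ℂ V)) (b : V → ℂ) (j : ι) :
    inner ℂ (ψ j) (WithLp.toLp 2 b) = ∑ v, b v * (starRingEnd ℂ) (ψ j v) := by
  rw [PiLp.inner_apply]
  refine Finset.sum_congr rfl fun v _ => ?_
  rw [RCLike.inner_apply]

theorem norm_sum_sq (f : V → ℂ) :
    ((‖∑ v, f v‖ ^ 2 : ℝ) : ℂ) = ∑ v, ∑ w, f v * (starRingEnd ℂ) (f w) := by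
  rw [Complex.ofReal_pow, ← Complex.mul_conj', map_sum, Finset.sum_mul_sum]

end Basis

theorem proj_out {T : Type*} {X : SimpleGraph T} {Γ : Subgroup (X ≃g X)} (v : Vert X Γ) :
    proj X Γ v.out = v := Quotient.out_eq v

variable {T : Type*} {X : SimpleGraph T} [X.LocallyFinite] {Γ : Subgroup (X ≃g X)}

variable (X Γ) in
open Classical in
/-- The kernel on the quotient graph of the operator summing over spheres of radius `d` of the
tree: the number of points over `w` at distance `d` from a chosen point over `v`. -/
noncomputable def sphereKernel (d : ℕ) (v w : Vert X Γ) : ℕ :=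
  ((sphere X v.out d).filter (fun y => proj X Γ y = w)).card

theorem adjFun_comp_proj [Fintype (Vert X Γ)] {f : EuclideanSpace ℂ (Vert X Γ)} {l : ℂ}
    (h : adjOp X Γ f = l • f) (y : T) :
    adjFun X (fun x => f (proj X Γ x)) y = l * f (proj X Γ y) :=
  congrArg (fun g : EuclideanSpace ℂ (Vert X Γ) => g (proj X Γ y)) h

theorem sum_sphereKernel [Fintype (Vert X Γ)] {q : ℕ} (hX : X.IsTree)
    (hreg : X.IsRegularOfDegree (q + 1)) (d : ℕ) (v : Vert X Γ) :
    ∑ w, (sphereKernel X Γ d v w : ℝ) = sphereEval q ((q : ℝ) + 1) d := by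
  classical
  rw [← card_sphere hX hreg v.out d, Finset.card_eq_sum_card_fiberwise (f := proj X Γ)
    (t := Finset.univ) (fun _ _ => Finset.mem_coe.2 (Finset.mem_univ _)), Nat.cast_sum]
  refine Finset.sum_congr rfl fun w _ => ?_
  unfold sphereKernel
  congr!

/-- At vertices whose injectivity radius is large, the entrywise product of sphere kernels is the
kernel of the product of the indicator functions of the spheres. -/
theorem sphereKernel_mul_sphereKernel (hX : X.IsTree) (hfree : ActsFreely X Γ) {R d e : ℕ}
    (hR : 0 < R) (hd : d ≤ R) (he : e ≤ R) {v : Vert X Γ} (hv : (R : ℕ∞) ≤ injRadius X Γ v)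
    (w : Vert X Γ) : sphereKernel X Γ d v w * sphereKernel X Γ e v w =
      if d = e then sphereKernel X Γ d v w else 0 := by
  classical
  have hc := hX.connected
  have hinj : ∀ {y y' : T}, X.dist v.out y ≤ R → X.dist v.out y' ≤ R → proj X Γ y = w →
      proj X Γ y' = w → y = y' := fun hy hy' h h' =>
    proj_injOn_of_le_injRadius hX hfree hR (by rwa [proj_out]) hy hy' (h.trans h'.symm)
  split_ifs with hde
  · subst hde
    have hle : sphereKernel X Γ d v w ≤ 1 := by
      refine Finset.card_le_one.2 fun y hy y' hy' => ?_
      rw [Finset.mem_filter, mem_sphere hc] at hy hy'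
      exact hinj (by omega) (by omega) hy.2 hy'.2
    interval_cases sphereKernel X Γ d v w <;> rfl
  · by_contra hne
    have h1 := Nat.pos_of_ne_zero (left_ne_zero_of_mul hne)
    have h2 := Nat.pos_of_ne_zero (right_ne_zero_of_mul hne)
    obtain ⟨y, hy⟩ := Finset.card_pos.1 h1
    obtain ⟨y', hy'⟩ := Finset.card_pos.1 h2
    rw [Finset.mem_filter, mem_sphere hc] at hy hy'
    have := hinj (by omega) (by omega) hy.2 hy'.2
    subst this
    omega

/-- The basis `ψ` consists of eigenvectors of the adjacency operator, the eigenvalue of `ψ j` being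
the real number `x j`. -/
def IsEigenbasis {ι : Type*} [Fintype ι] [Fintype (Vert X Γ)]
    (ψ : OrthonormalBasis ι ℂ (EuclideanSpace ℂ (Vert X Γ))) (x : ι → ℝ) : Prop :=
  ∀ j, adjOp X Γ (ψ j) = (x j : ℂ) • ψ j

section Eigenbasis

variable {ι : Type*} [Fintype ι] [Fintype (Vert X Γ)]
  {ψ : OrthonormalBasis ι ℂ (EuclideanSpace ℂ (Vert X Γ))} {x : ι → ℝ} {q : ℕ}

theorem sphereKernel_eq_sum (hX : X.IsTree) (hreg : X.IsRegularOfDegree (q + 1))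
    (hψ : IsEigenbasis ψ x) (d : ℕ) (v w : Vert X Γ) :
    (sphereKernel X Γ d v w : ℂ) =
      ∑ j, ((sphereEval q (x j) d : ℝ) : ℂ) * (ψ j v * (starRingEnd ℂ) (ψ j w)) := by
  classical
  have h1 : ∀ j, ∑ y ∈ sphere X v.out d, ψ j (proj X Γ y) =
      ((sphereEval q (x j) d : ℝ) : ℂ) * ψ j v := by
    intro j
    have := sum_sphere_of_eigen hX hreg (adjFun_comp_proj (hψ j)) v.out d
    rw [sphereEval_ofReal, proj_out] at this
    exact this
  calc (sphereKernel X Γ d v w : ℂ)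
      = ∑ y ∈ sphere X v.out d, if proj X Γ y = w then 1 else 0 := by
        unfold sphereKernel
        rw [Finset.card_filter]
        push_cast
        congr!
    _ = ∑ y ∈ sphere X v.out d, ∑ j, ψ j (proj X Γ y) * (starRingEnd ℂ) (ψ j w) :=
        Finset.sum_congr rfl fun y _ => (sum_basis_mul_conj ψ _ _).symm
    _ = ∑ j, ((sphereEval q (x j) d : ℝ) : ℂ) * (ψ j v * (starRingEnd ℂ) (ψ j w)) := by
        rw [Finset.sum_comm]
        refine Finset.sum_congr rfl fun j _ => ?_
        rw [← Finset.sum_mul, h1, mul_assoc]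

theorem sphereKernel_comm (hX : X.IsTree) (hreg : X.IsRegularOfDegree (q + 1))
    (hψ : IsEigenbasis ψ x) (d : ℕ) (v w : Vert X Γ) :
    sphereKernel X Γ d v w = sphereKernel X Γ d w v := by
  have h : (sphereKernel X Γ d v w : ℂ) = (starRingEnd ℂ) (sphereKernel X Γ d w v : ℂ) := by
    rw [sphereKernel_eq_sum hX hreg hψ, sphereKernel_eq_sum hX hreg hψ, map_sum]
    refine Finset.sum_congr rfl fun j _ => ?_
    simp only [map_mul, Complex.conj_conj, Complex.conj_ofReal]
    ring
  rw [Complex.conj_natCast] at h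
  exact_mod_cast h

/-- A trace formula: weighted Hilbert-Schmidt sums of a multiplication operator involve the
entrywise product of two kernels. -/
theorem sum_sphereEval_mul_norm_matrixCoeff (hX : X.IsTree) (hreg : X.IsRegularOfDegree (q + 1))
    (hψ : IsEigenbasis ψ x) (b : Vert X Γ → ℂ) (d e : ℕ) :
    ((∑ i, ∑ j, ‖matrixCoeff ψ b i j‖ ^ 2 * (sphereEval q (x i) d * sphereEval q (x j) e) : ℝ) : ℂ)
      = ∑ v, ∑ w, b v * (starRingEnd ℂ) (b w) *
        ((sphereKernel X Γ d v w * sphereKernel X Γ e v w : ℕ) : ℂ) := by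
  have hR : ∀ v w, b v * (starRingEnd ℂ) (b w) *
        ((sphereKernel X Γ d v w * sphereKernel X Γ e v w : ℕ) : ℂ) =
      ∑ i, ∑ j, ((sphereEval q (x i) d : ℝ) : ℂ) * ((sphereEval q (x j) e : ℝ) : ℂ) *
        ((b v * (ψ j v * (starRingEnd ℂ) (ψ i v))) *
          (starRingEnd ℂ) (b w * (ψ j w * (starRingEnd ℂ) (ψ i w)))) := by
    intro v w
    rw [Nat.cast_mul, sphereKernel_comm hX hreg hψ d v w, sphereKernel_eq_sum hX hreg hψ d,
      sphereKernel_eq_sum hX hreg hψ e, Finset.sum_mul_sum, Finset.mul_sum]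
    refine Finset.sum_congr rfl fun i _ => ?_
    rw [Finset.mul_sum]
    refine Finset.sum_congr rfl fun j _ => ?_
    simp only [map_mul, Complex.conj_conj]
    ring
  simp only [hR]
  have hL : ∀ i j, ((‖matrixCoeff ψ b i j‖ ^ 2 : ℝ) : ℂ) =
      ∑ v, ∑ w, (b v * (ψ j v * (starRingEnd ℂ) (ψ i v))) *
          (starRingEnd ℂ) (b w * (ψ j w * (starRingEnd ℂ) (ψ i w))) := by
    intro i j
    rw [matrixCoeff_eq_sum, norm_sum_sq]
  have hcomm : ∀ F : Vert X Γ → Vert X Γ → ι → ι → ℂ,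
      ∑ v, ∑ w, ∑ i, ∑ j, F v w i j = ∑ i, ∑ j, ∑ v, ∑ w, F v w i j := by
    intro F
    calc _ = ∑ v, ∑ i, ∑ j, ∑ w, F v w i j := by
          refine Finset.sum_congr rfl fun v _ => ?_
          rw [Finset.sum_comm]
          exact Finset.sum_congr rfl fun i _ => Finset.sum_comm
      _ = _ := by
          rw [Finset.sum_comm]
          exact Finset.sum_congr rfl fun i _ => Finset.sum_comm
  rw [hcomm, Complex.ofReal_sum]
  refine Finset.sum_congr rfl fun i _ => ?_
  rw [Complex.ofReal_sum]
  refine Finset.sum_congr rfl fun j _ => ?_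
  rw [Complex.ofReal_mul, hL, Complex.ofReal_mul, mul_comm, Finset.mul_sum]
  refine Finset.sum_congr rfl fun v _ => ?_
  rw [Finset.mul_sum]

theorem sum_sphereEval_mul_norm_inner (hX : X.IsTree) (hreg : X.IsRegularOfDegree (q + 1))
    (hψ : IsEigenbasis ψ x) (b : Vert X Γ → ℂ) (d : ℕ) :
    ((∑ j, sphereEval q (x j) d * ‖(inner ℂ (ψ j) (WithLp.toLp 2 b) : ℂ)‖ ^ 2 : ℝ) : ℂ)
      = ∑ v, ∑ w, b v * (starRingEnd ℂ) (b w) * (sphereKernel X Γ d v w : ℂ) := by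
  have hR : ∀ v w, b v * (starRingEnd ℂ) (b w) * (sphereKernel X Γ d v w : ℂ) =
      ∑ j, ((sphereEval q (x j) d : ℝ) : ℂ) * ((b v * (starRingEnd ℂ) (ψ j v)) *
          (starRingEnd ℂ) (b w * (starRingEnd ℂ) (ψ j w))) := by
    intro v w
    rw [sphereKernel_comm hX hreg hψ d v w, sphereKernel_eq_sum hX hreg hψ d, Finset.mul_sum]
    refine Finset.sum_congr rfl fun j _ => ?_
    simp only [map_mul, Complex.conj_conj]
    ring
  simp only [hR]
  have hcomm : ∀ F : Vert X Γ → Vert X Γ → ι → ℂ,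
      ∑ v, ∑ w, ∑ j, F v w j = ∑ j, ∑ v, ∑ w, F v w j := by
    intro F
    rw [Finset.sum_comm (γ := ι)]
    exact Finset.sum_congr rfl fun v _ => Finset.sum_comm
  rw [hcomm, Complex.ofReal_sum]
  refine Finset.sum_congr rfl fun j _ => ?_
  rw [Complex.ofReal_mul, inner_toLp_eq_sum, norm_sum_sq, Finset.mul_sum]
  refine Finset.sum_congr rfl fun v _ => ?_
  rw [Finset.mul_sum]

/-- The vertices with injectivity radius less than `R` are the only ones contributing to the
difference between the entrywise product of kernels and the kernel of the product. -/
theorem abs_sum_matrixCoeff_sub_le (hX : X.IsTree) (hreg : X.IsRegularOfDegree (q + 1))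
    (hfree : ActsFreely X Γ) (hψ : IsEigenbasis ψ x) {b : Vert X Γ → ℂ} (hb : ∀ v, ‖b v‖ ≤ 2)
    {R d e : ℕ} (hR : 0 < R) (hd : d ≤ R) (he : e ≤ R) :
    |∑ i, ∑ j, ‖matrixCoeff ψ b i j‖ ^ 2 * (sphereEval q (x i) d * sphereEval q (x j) e)
      - (if d = e then ∑ j, sphereEval q (x j) d * ‖(inner ℂ (ψ j) (WithLp.toLp 2 b) : ℂ)‖ ^ 2
        else 0)| ≤
    4 * (sphereEval q ((q : ℝ) + 1) d * sphereEval q ((q : ℝ) + 1) e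
      + sphereEval q ((q : ℝ) + 1) d) * {v : Vert X Γ | injRadius X Γ v < R}.ncard := by
  classical
  set σ : ℕ → ℝ := fun d => sphereEval q ((q : ℝ) + 1) d with hσ
  set N : ℕ → Vert X Γ → Vert X Γ → ℕ := sphereKernel X Γ with hN
  have hmain : (((if d = e then ∑ j, sphereEval q (x j) d *
      ‖(inner ℂ (ψ j) (WithLp.toLp 2 b) : ℂ)‖ ^ 2 else 0 : ℝ)) : ℂ) =
      ∑ v, ∑ w, b v * (starRingEnd ℂ) (b w) * ((if d = e then N d v w else 0 : ℕ) : ℂ) := by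
    split_ifs with hde
    · exact sum_sphereEval_mul_norm_inner hX hreg hψ b d
    · simp
  rw [← Real.norm_eq_abs, ← Complex.norm_real, Complex.ofReal_sub, hmain,
    sum_sphereEval_mul_norm_matrixCoeff hX hreg hψ, ← Finset.sum_sub_distrib]
  simp only [← Finset.sum_sub_distrib, ← mul_sub]
  have hNσ : ∀ d v, ∑ w, (N d v w : ℝ) = σ d := fun d v => sum_sphereKernel hX hreg d v
  have hle : ∀ d v w, (N d v w : ℝ) ≤ σ d := fun d v w => by
    rw [← hNσ d v]
    exact Finset.single_le_sum (f := fun w => (N d v w : ℝ)) (fun _ _ => Nat.cast_nonneg _)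
      (Finset.mem_univ w)
  have hrow : ∀ v, ‖∑ w, b v * (starRingEnd ℂ) (b w) *
      (((N d v w * N e v w : ℕ) : ℂ) - ((if d = e then N d v w else 0 : ℕ) : ℂ))‖ ≤
      if injRadius X Γ v < R then 4 * (σ d * σ e + σ d) else 0 := by
    intro v
    by_cases hv : injRadius X Γ v < R
    · rw [if_pos hv]
      have hterm : ∀ w, ‖b v * (starRingEnd ℂ) (b w) *
          (((N d v w * N e v w : ℕ) : ℂ) - ((if d = e then N d v w else 0 : ℕ) : ℂ))‖ ≤
          4 * (N d v w * σ e + N d v w) := by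
        intro w
        rw [norm_mul, norm_mul, RCLike.norm_conj]
        have h4 : ‖b v‖ * ‖b w‖ ≤ 4 := by
          have := mul_le_mul (hb v) (hb w) (norm_nonneg _) (by norm_num)
          linarith
        refine mul_le_mul h4 ?_ (norm_nonneg _) (by norm_num)
        refine (norm_sub_le _ _).trans ?_
        rw [Complex.norm_natCast, Complex.norm_natCast]
        push_cast
        refine add_le_add (mul_le_mul_of_nonneg_left (hle e v w) (Nat.cast_nonneg _)) ?_
        split_ifs
        · exact le_rfl
        · simp
      refine (norm_sum_le _ _).trans ((Finset.sum_le_sum fun w _ => hterm w).trans (le_of_eq ?_))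
      rw [← Finset.mul_sum, Finset.sum_add_distrib, ← Finset.sum_mul, hNσ]
    · rw [if_neg hv]
      rw [not_lt] at hv
      refine le_of_eq ?_
      rw [norm_eq_zero]
      refine Finset.sum_eq_zero fun w _ => ?_
      rw [hN, sphereKernel_mul_sphereKernel hX hfree hR hd he hv w, sub_self, mul_zero]
  refine (norm_sum_le _ _).trans ((Finset.sum_le_sum fun v _ => hrow v).trans (le_of_eq ?_))
  rw [← Finset.sum_filter, Finset.sum_const, nsmul_eq_mul, mul_comm]
  congr 2
  rw [← Set.ncard_coe_finset]
  congr 1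
  ext v
  simp

end Eigenbasis

end QuantumErgodicity

/-! ### The spectral gap -/

namespace QuantumErgodicity

variable {T : Type*} {X : SimpleGraph T} [X.LocallyFinite]

/-- A maximum principle: a harmonic function attaining its maximum is constant. -/
theorem eq_of_harmonic_of_le {q : ℕ} (hX : X.Connected) (hreg : X.IsRegularOfDegree (q + 1))
    {u : T → ℝ} (hu : ∀ y, ∑ z ∈ X.neighborFinset y, u z = (q + 1) * u y) {x₀ : T}
    (hmax : ∀ y, u y ≤ u x₀) (y : T) : u y = u x₀ := by
  have hstep : ∀ y z, X.Adj y z → u y = u x₀ → u z = u x₀ := by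
    intro y z hyz hy
    have hsum : ∑ z ∈ X.neighborFinset y, (u x₀ - u z) = 0 := by
      rw [Finset.sum_sub_distrib, hu, Finset.sum_const,
        SimpleGraph.card_neighborFinset_eq_degree, hreg y, hy, nsmul_eq_mul]
      push_cast
      ring
    rw [Finset.sum_eq_zero_iff_of_nonneg (fun z _ => sub_nonneg.2 (hmax z))] at hsum
    linarith [hsum z (by rwa [SimpleGraph.mem_neighborFinset])]
  obtain ⟨p⟩ := hX.preconnected x₀ y
  have hwalk : ∀ a b : T, X.Walk a b → u a = u x₀ → u b = u x₀ := by
    intro a b p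
    induction p with
    | nil => exact id
    | cons h _ ih => exact fun ha => ih (hstep _ _ h ha)
  exact hwalk _ _ p rfl

variable {Γ : Subgroup (X ≃g X)} [Fintype (Vert X Γ)]

/-- The trivial eigenvalue `q + 1` has only the constants as eigenfunctions. -/
theorem eq_of_adjOp_eq {q : ℕ} (hX : X.Connected) (hreg : X.IsRegularOfDegree (q + 1))
    {f : EuclideanSpace ℂ (Vert X Γ)} (hf : adjOp X Γ f = ((q : ℂ) + 1) • f) (v w : Vert X Γ) :
    f v = f w := by
  have key : ∀ L : ℂ →ₗ[ℝ] ℝ, L (f v) = L (f w) := by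
    intro L
    obtain ⟨x⟩ := hX.nonempty
    have : Nonempty (Vert X Γ) := ⟨proj X Γ x⟩
    obtain ⟨v₀, hv₀⟩ := Finite.exists_max (fun v => L (f v))
    have hu : ∀ y, ∑ z ∈ X.neighborFinset y, L (f (proj X Γ z)) =
        (q + 1) * L (f (proj X Γ y)) := by
      intro y
      have h := adjFun_comp_proj hf y
      have h2 : ((q : ℂ) + 1) * f (proj X Γ y) = ((q : ℝ) + 1) • f (proj X Γ y) := by
        rw [Complex.real_smul]
        push_cast
        rfl
      rw [adjFun, h2] at h
      rw [← map_sum, h, map_smul, smul_eq_mul]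
    have hc := eq_of_harmonic_of_le hX hreg hu (x₀ := v₀.out)
      (fun y => by rw [proj_out]; exact hv₀ _)
    have h1 := hc v.out
    have h2 := hc w.out
    rw [proj_out] at h1 h2
    rw [h1, h2]
  exact Complex.ext (key Complex.reLm) (key Complex.imLm)

variable {ι : Type*} [Fintype ι] {ψ : OrthonormalBasis ι ℂ (EuclideanSpace ℂ (Vert X Γ))}
  {x : ι → ℝ} {q : ℕ}

theorem basis_apply_ne_zero {V : Type*} [Fintype V] (ψ : OrthonormalBasis ι ℂ (EuclideanSpace ℂ V))
    {j : ι} (h : ∀ v w, ψ j v = ψ j w) (v : V) : ψ j v ≠ 0 := by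
  intro h0
  apply ψ.orthonormal.ne_zero j
  ext w
  rw [h w v, h0]
  rfl

theorem inner_toLp_eq_zero (hX : X.Connected) (hreg : X.IsRegularOfDegree (q + 1))
    (hψ : IsEigenbasis ψ x) {b : Vert X Γ → ℂ} (hb : ∑ v, b v = 0) {j : ι} (hj : x j = q + 1) :
    (inner ℂ (ψ j) (WithLp.toLp 2 b) : ℂ) = 0 := by
  have hc := eq_of_adjOp_eq hX hreg (f := ψ j) (by rw [hψ j, hj]; push_cast; rfl)
  obtain ⟨y⟩ := hX.nonempty
  rw [inner_toLp_eq_sum]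
  simp only [fun v => hc v (proj X Γ y)]
  rw [← Finset.sum_mul, hb, zero_mul]

theorem eq_of_trivial_eigenvalue (hX : X.Connected) (hreg : X.IsRegularOfDegree (q + 1))
    (hψ : IsEigenbasis ψ x) {i j : ι} (hi : x i = q + 1) (hj : x j = q + 1) : i = j := by
  have hci := eq_of_adjOp_eq hX hreg (f := ψ i) (by rw [hψ i, hi]; push_cast; rfl)
  have hcj := eq_of_adjOp_eq hX hreg (f := ψ j) (by rw [hψ j, hj]; push_cast; rfl)
  obtain ⟨y⟩ := hX.nonempty
  have : Nonempty (Vert X Γ) := ⟨proj X Γ y⟩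
  by_contra hij
  have h := ψ.inner_eq_zero hij
  rw [show ψ j = WithLp.toLp 2 (fun v => ψ j v) from rfl, inner_toLp_eq_sum] at h
  simp only [fun v => hci v (proj X Γ y), fun v => hcj v (proj X Γ y)] at h
  rw [Finset.sum_const, Finset.card_univ, nsmul_eq_mul] at h
  have h1 := basis_apply_ne_zero ψ hci (proj X Γ y)
  have h2 := basis_apply_ne_zero ψ hcj (proj X Γ y)
  have h3 : (starRingEnd ℂ) (ψ i (proj X Γ y)) ≠ 0 := (map_ne_zero _).2 h1
  exact mul_ne_zero (Nat.cast_ne_zero.2 Fintype.card_ne_zero) (mul_ne_zero h2 h3) h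

theorem exists_isEigenbasis {β : ℝ}
    (hspec : spectrum ℂ (((q : ℂ) + 1)⁻¹ • adjOp X Γ) ⊆
      (fun t : ℝ => (t : ℂ)) '' ({1} ∪ Set.Icc (-1 + β) (1 - β)))
    (h : ∀ j, ∃ l : ℂ, adjOp X Γ (ψ j) = l • ψ j) :
    ∃ x : ι → ℝ, IsEigenbasis ψ x ∧ ∀ j, x j = q + 1 ∨ |x j| ≤ (q + 1) * (1 - β) := by
  have hq : (0 : ℝ) < q + 1 := by positivity
  have hq' : (q : ℂ) + 1 ≠ 0 := by exact_mod_cast hq.ne'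
  have key : ∀ j, ∃ t : ℝ, adjOp X Γ (ψ j) = (t : ℂ) • ψ j ∧
      (t = q + 1 ∨ |t| ≤ (q + 1) * (1 - β)) := by
    intro j
    obtain ⟨l, hl⟩ := h j
    have hev : Module.End.HasEigenvalue (((q : ℂ) + 1)⁻¹ • adjOp X Γ) (((q : ℂ) + 1)⁻¹ * l) := by
      refine Module.End.hasEigenvalue_of_hasEigenvector (x := ψ j)
        ⟨Module.End.mem_eigenspace_iff.2 ?_, ψ.orthonormal.ne_zero j⟩
      rw [LinearMap.smul_apply, hl, smul_smul]
    obtain ⟨t, ht, hlt⟩ := hspec hev.mem_spectrum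
    have hl' : l = (((q + 1) * t : ℝ) : ℂ) := by
      have : (t : ℂ) = ((q : ℂ) + 1)⁻¹ * l := hlt
      push_cast
      rw [this, mul_inv_cancel_left₀ hq']
    refine ⟨(q + 1) * t, by rw [hl, hl'], ?_⟩
    rcases ht with ht | ht
    · left
      rw [Set.mem_singleton_iff.1 ht, mul_one]
    · right
      rw [abs_mul, abs_of_pos hq]
      refine mul_le_mul_of_nonneg_left ?_ hq.le
      rw [abs_le]
      exact ⟨by linarith [ht.1], ht.2⟩
  choose x hx using key
  exact ⟨x, fun j => (hx j).1, fun j => (hx j).2⟩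

theorem abs_sum_sphereEval_mul_norm_inner_le (hX : X.Connected)
    (hreg : X.IsRegularOfDegree (q + 1)) (hψ : IsEigenbasis ψ x) {Λ K : ℝ} {d : ℕ} (hK : 0 ≤ K)
    (hΛ : ∀ t : ℝ, |t| ≤ Λ → |sphereEval q t d| ≤ K)
    (hx : ∀ j, x j = q + 1 ∨ |x j| ≤ Λ) {b : Vert X Γ → ℂ} (hb0 : ∑ v, b v = 0)
    (hb : ∀ v, ‖b v‖ ≤ 2) :
    |∑ j, sphereEval q (x j) d * ‖(inner ℂ (ψ j) (WithLp.toLp 2 b) : ℂ)‖ ^ 2| ≤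
      K * (4 * Fintype.card (Vert X Γ)) := by
  have h1 : ∑ j, ‖(inner ℂ (ψ j) (WithLp.toLp 2 b) : ℂ)‖ ^ 2 ≤ 4 * Fintype.card (Vert X Γ) := by
    rw [ψ.sum_sq_norm_inner_right, EuclideanSpace.norm_sq_eq]
    calc ∑ v, ‖b v‖ ^ 2 ≤ ∑ _v : Vert X Γ, (4 : ℝ) := by
          refine Finset.sum_le_sum fun v _ => ?_
          have := pow_le_pow_left₀ (norm_nonneg _) (hb v) 2
          linarith
      _ = _ := by rw [Finset.sum_const, Finset.card_univ, nsmul_eq_mul, mul_comm]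
  refine (Finset.abs_sum_le_sum_abs _ _).trans (le_trans ?_ (mul_le_mul_of_nonneg_left h1 hK))
  rw [Finset.mul_sum]
  refine Finset.sum_le_sum fun j _ => ?_
  rw [abs_mul, abs_of_nonneg (sq_nonneg ‖_‖)]
  rcases hx j with hj | hj
  · rw [inner_toLp_eq_zero hX hreg hψ hb0 hj]
    simp
  · exact mul_le_mul_of_nonneg_right (hΛ _ hj) (sq_nonneg _)

/-! ### The quantum variance -/

theorem sum_pow_range_le {r : ℝ} (hr : 1 < r) (m : ℕ) :
    ∑ d ∈ Finset.range (m + 1), r ^ d ≤ r / (r - 1) * r ^ m := by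
  rw [geom_sum_eq hr.ne', div_mul_eq_mul_div, ← pow_succ']
  have : 0 < r - 1 := by linarith
  gcongr
  linarith

/-- A quantitative estimate for the quantum variance of an observable of mean zero: up to the
contribution of the vertices with small injectivity radius, it is inversely proportional to the
length `M` of the time average. -/
theorem exists_sum_norm_matrixCoeff_le (hq : 2 ≤ q) (hX : X.IsTree)
    (hreg : X.IsRegularOfDegree (q + 1)) {β : ℝ} (hβ : 0 < β) :
    ∃ K : ℝ, 0 ≤ K ∧ ∀ M : ℕ, 0 < M → ∃ E : ℝ, 0 ≤ E ∧
      ∀ (Γ : Subgroup (X ≃g X)) [Fintype (Vert X Γ)], ActsFreely X Γ →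
      ∀ {ι : Type} [Fintype ι] (ψ : OrthonormalBasis ι ℂ (EuclideanSpace ℂ (Vert X Γ))) (x : ι → ℝ),
      IsEigenbasis ψ x → (∀ j, x j = q + 1 ∨ |x j| ≤ (q + 1) * (1 - β)) →
      ∀ b : Vert X Γ → ℂ, ∑ v, b v = 0 → (∀ v, ‖b v‖ ≤ 2) →
      ∑ j, ‖matrixCoeff ψ b j j‖ ^ 2 ≤ K / M * Fintype.card (Vert X Γ) +
        E * {v : Vert X Γ | injRadius X Γ v < (4 * M : ℕ)}.ncard := by
  obtain ⟨r, C, hr, hrq, hC, hdecay⟩ := exists_abs_sphereEval_le hq hβ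
  choose c hc _ hdick using exists_dickson_eq_sum q
  have hr1 : 0 < r - 1 := by linarith
  have hq0 : (0 : ℝ) < q := by linarith
  have hσ1 : 0 < 1 - r / q := by rw [sub_pos, div_lt_one hq0]; exact hrq
  set A : ℝ := (q + 2) ^ 2 * (4 * C) * (r / (r - 1)) with hA
  have hA0 : 0 ≤ A := by positivity
  have hσ0 : ∀ d, 0 ≤ sphereEval q ((q : ℝ) + 1) d := fun d => by
    obtain ⟨y⟩ := hX.connected.nonempty
    rw [← card_sphere hX hreg y d]
    positivity
  refine ⟨64 / 49 * (16 * A * (1 - r / q)⁻¹), by positivity, fun M hM => ?_⟩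
  set E : ℝ := ∑ d ∈ Finset.range (4 * M + 1), ∑ e ∈ Finset.range (4 * M + 1),
    (q + 2 : ℝ) ^ 2 * (4 * (sphereEval q ((q : ℝ) + 1) d * sphereEval q ((q : ℝ) + 1) e
      + sphereEval q ((q : ℝ) + 1) d)) with hE
  have hterm0 : ∀ d e, 0 ≤ (q + 2 : ℝ) ^ 2 * (4 * (sphereEval q ((q : ℝ) + 1) d *
      sphereEval q ((q : ℝ) + 1) e + sphereEval q ((q : ℝ) + 1) d)) := fun d e => by
    have h1 := hσ0 d
    have h2 := hσ0 e
    positivity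
  have hE0 : 0 ≤ E := Finset.sum_nonneg fun d _ => Finset.sum_nonneg fun e _ => hterm0 d e
  refine ⟨64 / 49 * (16 * E), by positivity, ?_⟩
  intro Γ _ hfree ι _ ψ x hψ hx b hb0 hb
  set n : ℝ := (Fintype.card (Vert X Γ) : ℝ) with hn
  set bad : ℝ := ({v : Vert X Γ | injRadius X Γ v < (4 * M : ℕ)}.ncard : ℝ) with hbad
  have hbad0 : 0 ≤ bad := Nat.cast_nonneg _
  set P : ℕ → ℝ := fun d =>
    ∑ j, sphereEval q (x j) d * ‖(inner ℂ (ψ j) (WithLp.toLp 2 b) : ℂ)‖ ^ 2 with hP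
  set Q : ℕ → ℕ → ℝ := fun d e =>
    ∑ i, ∑ j, ‖matrixCoeff ψ b i j‖ ^ 2 * (sphereEval q (x i) d * sphereEval q (x j) e) with hQ
  have hPle : ∀ d, |P d| ≤ C * r ^ d * (4 * n) := fun d =>
    abs_sum_sphereEval_mul_norm_inner_le hX.connected hreg hψ (by positivity)
      (fun t ht => hdecay t ht d) hx hb0 hb
  have hcc : ∀ k l d e, |c k d * c l e| ≤ (q + 2 : ℝ) ^ 2 := fun k l d e => by
    rw [abs_mul, pow_two]
    exact mul_le_mul (hc k d) (hc l e) (abs_nonneg _) (by positivity)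
  have hF : ∀ k l, k ≤ 4 * M → l ≤ 4 * M →
      |∑ i, ∑ j, ‖matrixCoeff ψ b i j‖ ^ 2 * (dickson q (x i) k * dickson q (x j) l)| ≤
        A * n * r ^ (min k l) + E * bad := by
    intro k l hk hl
    have hexp : ∑ i, ∑ j, ‖matrixCoeff ψ b i j‖ ^ 2 * (dickson q (x i) k * dickson q (x j) l) =
        ∑ d ∈ Finset.range (k + 1), ∑ e ∈ Finset.range (l + 1), c k d * c l e * Q d e := by
      have hij : ∀ i j, ‖matrixCoeff ψ b i j‖ ^ 2 * (dickson q (x i) k * dickson q (x j) l) =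
          ∑ d ∈ Finset.range (k + 1), ∑ e ∈ Finset.range (l + 1), c k d * c l e *
            (‖matrixCoeff ψ b i j‖ ^ 2 * (sphereEval q (x i) d * sphereEval q (x j) e)) := by
        intro i j
        rw [hdick, hdick, Finset.sum_mul_sum, Finset.mul_sum]
        refine Finset.sum_congr rfl fun d _ => ?_
        rw [Finset.mul_sum]
        refine Finset.sum_congr rfl fun e _ => ?_
        ring
      simp only [hij, hQ, Finset.mul_sum]
      have hj : ∀ i, ∑ j, ∑ d ∈ Finset.range (k + 1), ∑ e ∈ Finset.range (l + 1), c k d * c l e *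
            (‖matrixCoeff ψ b i j‖ ^ 2 * (sphereEval q (x i) d * sphereEval q (x j) e)) =
          ∑ d ∈ Finset.range (k + 1), ∑ e ∈ Finset.range (l + 1), ∑ j, c k d * c l e *
            (‖matrixCoeff ψ b i j‖ ^ 2 * (sphereEval q (x i) d * sphereEval q (x j) e)) := by
        intro i
        rw [Finset.sum_comm]
        exact Finset.sum_congr rfl fun d _ => Finset.sum_comm
      simp only [hj]
      rw [Finset.sum_comm (s := Finset.univ)]
      exact Finset.sum_congr rfl fun d _ => Finset.sum_comm
    have hsplit : ∑ d ∈ Finset.range (k + 1), ∑ e ∈ Finset.range (l + 1), c k d * c l e * Q d e =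
        ∑ d ∈ Finset.range (k + 1), ∑ e ∈ Finset.range (l + 1),
          c k d * c l e * (if d = e then P d else 0) +
        ∑ d ∈ Finset.range (k + 1), ∑ e ∈ Finset.range (l + 1),
          c k d * c l e * (Q d e - if d = e then P d else 0) := by
      simp only [← Finset.sum_add_distrib]
      refine Finset.sum_congr rfl fun d _ => Finset.sum_congr rfl fun e _ => ?_
      ring
    rw [hexp, hsplit]
    refine (abs_add_le _ _).trans (add_le_add ?_ ?_)
    · have hd : ∀ d, |∑ e ∈ Finset.range (l + 1), c k d * c l e * (if d = e then P d else 0)| ≤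
          if d < l + 1 then (q + 2 : ℝ) ^ 2 * (C * r ^ d * (4 * n)) else 0 := by
        intro d
        simp only [mul_ite, mul_zero, Finset.sum_ite_eq, Finset.mem_range]
        split_ifs
        · rw [abs_mul]
          exact mul_le_mul (hcc _ _ _ _) (hPle d) (abs_nonneg _) (by positivity)
        · simp
      refine (Finset.abs_sum_le_sum_abs _ _).trans ((Finset.sum_le_sum fun d _ => hd d).trans ?_)
      rw [← Finset.sum_filter]
      have hfil : (Finset.range (k + 1)).filter (fun d => d < l + 1) =
          Finset.range (min k l + 1) := by
        ext d
        simp only [Finset.mem_filter, Finset.mem_range]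
        omega
      rw [hfil]
      calc ∑ d ∈ Finset.range (min k l + 1), (q + 2 : ℝ) ^ 2 * (C * r ^ d * (4 * n))
          = (q + 2 : ℝ) ^ 2 * (4 * C) * n * ∑ d ∈ Finset.range (min k l + 1), r ^ d := by
            rw [Finset.mul_sum]
            exact Finset.sum_congr rfl fun d _ => by ring
        _ ≤ (q + 2 : ℝ) ^ 2 * (4 * C) * n * (r / (r - 1) * r ^ (min k l)) := by
            gcongr
            exact sum_pow_range_le hr _
        _ = _ := by rw [hA]; ring
    · have hde : ∀ d ∈ Finset.range (k + 1), ∀ e ∈ Finset.range (l + 1),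
          |c k d * c l e * (Q d e - if d = e then P d else 0)| ≤
          (q + 2 : ℝ) ^ 2 * (4 * (sphereEval q ((q : ℝ) + 1) d * sphereEval q ((q : ℝ) + 1) e
            + sphereEval q ((q : ℝ) + 1) d)) * bad := by
        intro d hd e he
        rw [Finset.mem_range] at hd he
        rw [abs_mul, mul_assoc]
        exact mul_le_mul (hcc _ _ _ _) (abs_sum_matrixCoeff_sub_le hX hreg hfree hψ hb
          (by omega) (by omega) (by omega)) (abs_nonneg _) (by positivity)
      refine (Finset.abs_sum_le_sum_abs _ _).trans ((Finset.sum_le_sum fun d hd =>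
        (Finset.abs_sum_le_sum_abs _ _).trans
          (Finset.sum_le_sum fun e he => hde d hd e he)).trans ?_)
      simp only [← Finset.sum_mul]
      refine mul_le_mul_of_nonneg_right ?_ hbad0
      refine (Finset.sum_le_sum_of_subset_of_nonneg
        (Finset.range_subset_range.2 (by omega : k + 1 ≤ 4 * M + 1))
        (fun d _ _ => Finset.sum_nonneg fun e _ => hterm0 d e)).trans ?_
      refine Finset.sum_le_sum fun d _ => ?_
      exact Finset.sum_le_sum_of_subset_of_nonneg
        (Finset.range_subset_range.2 (by omega)) (fun e _ _ => hterm0 d e)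
  have hdiag := sum_diag_le hr hrq x (fun i j => ‖matrixCoeff ψ b i j‖ ^ 2)
    (fun _ _ => sq_nonneg _) (A := A * n) (B := E * bad) (by positivity) (by positivity) M hF
  have hM' : (0 : ℝ) < M := by exact_mod_cast hM
  have hfin : (7 / 8 * (M : ℝ)) ^ 2 * ∑ j, ‖matrixCoeff ψ b j j‖ ^ 2 ≤
      (7 / 8 * (M : ℝ)) ^ 2 * (64 / 49 * (16 * A * (1 - r / q)⁻¹) / M * n +
        64 / 49 * (16 * E) * bad) := by
    refine hdiag.trans (le_of_eq ?_)
    field_simp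
    ring
  exact le_of_mul_le_mul_left hfin (by positivity)

/-! ### Degree at most two -/

theorem sphereEval_zero_one (n : ℕ) : sphereEval 0 (1 : ℝ) (n + 2) = 0 := by
  induction n with
  | zero => simp [sphereEval]
  | succ n ih => rw [sphereEval_succ_succ, ih]; simp

/-- The `1`-regular tree has two vertices. -/
theorem card_vert_le_two (hX : X.IsTree) (hreg : X.IsRegularOfDegree (0 + 1)) :
    Fintype.card (Vert X Γ) ≤ 2 := by
  classical
  obtain ⟨y⟩ := hX.connected.nonempty
  have hcard : ∀ n, ((sphere X y n).card : ℝ) = sphereEval 0 (1 : ℝ) n := fun n => by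
    simpa using card_sphere hX hreg y n
  have hsub : (Finset.univ : Finset (Vert X Γ)) ⊆
      (sphere X y 0).image (proj X Γ) ∪ (sphere X y 1).image (proj X Γ) := by
    intro v _
    have hmem : v.out ∈ sphere X y (X.dist y v.out) := (mem_sphere hX.connected).2 rfl
    have hlt : X.dist y v.out < 2 := by
      by_contra! hge
      obtain ⟨k, hk⟩ := Nat.exists_eq_add_of_le' hge
      have h := hcard (X.dist y v.out)
      rw [hk, sphereEval_zero_one, ← hk, Nat.cast_eq_zero, Finset.card_eq_zero] at h
      rw [h] at hmem
      simp at hmem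
    rw [Finset.mem_union, Finset.mem_image, Finset.mem_image]
    interval_cases h : X.dist y v.out
    · exact Or.inl ⟨_, hmem, proj_out v⟩
    · exact Or.inr ⟨_, hmem, proj_out v⟩
  have h0 : (sphere X y 0).card = 1 := by
    have := hcard 0
    simp only [sphereEval] at this
    exact_mod_cast this
  have h1 : (sphere X y 1).card = 1 := by
    have := hcard 1
    simp only [sphereEval] at this
    exact_mod_cast this
  calc Fintype.card (Vert X Γ) ≤ _ := Finset.card_le_card hsub
    _ ≤ _ := Finset.card_union_le _ _
    _ ≤ 1 + 1 := add_le_add (Finset.card_image_le.trans h0.le) (Finset.card_image_le.trans h1.le)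

theorem sub_two_mul_sum_sphereEval_one (t : ℝ) (n : ℕ) :
    (t - 2) * ∑ d ∈ Finset.range (n + 2), sphereEval 1 t d =
      sphereEval 1 t (n + 2) - sphereEval 1 t (n + 1) := by
  induction n with
  | zero => simp [Finset.sum_range_succ, sphereEval]; ring
  | succ n ih =>
    rw [Finset.sum_range_succ, mul_add, ih, sphereEval_succ_succ 1 t (n + 1),
      if_neg (by omega)]
    push_cast
    ring

theorem sphereEval_one_two (n : ℕ) : sphereEval 1 (2 : ℝ) (n + 1) = 2 := by
  induction n using Nat.twoStepInduction with
  | zero => simp [sphereEval]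
  | one => simp [sphereEval]; norm_num
  | more n h0 h1 =>
    rw [sphereEval_succ_succ, h1, h0, if_neg (by omega)]
    norm_num

theorem sum_sphereEval_mul_sphereEval (hX : X.IsTree) (hreg : X.IsRegularOfDegree (q + 1))
    (hψ : IsEigenbasis ψ x) (d e : ℕ) :
    ∑ j, sphereEval q (x j) d * sphereEval q (x j) e =
      ∑ v, ∑ w, (sphereKernel X Γ d v w : ℝ) * sphereKernel X Γ e v w := by
  classical
  have h := sum_sphereEval_mul_norm_matrixCoeff hX hreg hψ (fun _ => 1) d e
  -- For the constant observable the matrix coefficients form the identity matrix.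
  have hδ : ∀ i j, matrixCoeff ψ (fun _ => 1) i j = if i = j then 1 else 0 := by
    intro i j
    unfold matrixCoeff
    simp only [one_mul]
    exact orthonormal_iff_ite.1 ψ.orthonormal i j
  have hsum : ∀ i, ∑ j, ‖matrixCoeff ψ (fun _ => 1) i j‖ ^ 2 *
      (sphereEval q (x i) d * sphereEval q (x j) e) =
      sphereEval q (x i) d * sphereEval q (x i) e := by
    intro i
    rw [Finset.sum_eq_single i]
    · rw [hδ, if_pos rfl]; simp
    · intro j _ hij
      rw [hδ, if_neg hij.symm]; simp
    · simp
  simp only [hsum] at h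
  simp only [map_one, mul_one, one_mul] at h
  exact_mod_cast h

/-- Cycles do not form expanders: a spectral gap bounds the size of a quotient of the line. The
Dirichlet kernel is bounded away from the trivial eigenvalue, while its Hilbert-Schmidt norm is
large. -/
theorem exists_card_vert_le (hX : X.IsTree) (hreg : X.IsRegularOfDegree (1 + 1)) {β : ℝ}
    (hβ : 0 < β) : ∃ B : ℝ, ∀ (Γ : Subgroup (X ≃g X)) [Fintype (Vert X Γ)] {ι : Type}
      [Fintype ι] (ψ : OrthonormalBasis ι ℂ (EuclideanSpace ℂ (Vert X Γ))) (x : ι → ℝ),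
      IsEigenbasis ψ x → (∀ j, x j = (1 : ℕ) + 1 ∨ |x j| ≤ ((1 : ℕ) + 1) * (1 - β)) →
      (Fintype.card (Vert X Γ) : ℝ) ≤ B := by
  classical
  obtain ⟨C, hC, hdecay⟩ := abs_sphereEval_le (q := 1) (r := 1) one_pos (by norm_num) hβ
  obtain ⟨M, hM⟩ := exists_nat_ge ((C / β) ^ 2 + 1)
  refine ⟨(2 * (M + 2 : ℕ)) ^ 2, ?_⟩
  intro Γ _ ι _ ψ x hψ hx
  set n : ℝ := (Fintype.card (Vert X Γ) : ℝ) with hn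
  set p : ι → ℝ := fun j => ∑ d ∈ Finset.range (M + 2), sphereEval 1 (x j) d with hp
  set N : Vert X Γ → Vert X Γ → ℕ :=
    fun v w => ∑ d ∈ Finset.range (M + 2), sphereKernel X Γ d v w with hN
  have hσ : ∀ d, 1 ≤ sphereEval 1 (((1 : ℕ) : ℝ) + 1) d := by
    intro d
    rw [show ((1 : ℕ) : ℝ) + 1 = 2 by norm_num]
    rcases d with _ | d
    · simp [sphereEval]
    · rw [sphereEval_one_two]; norm_num
  have hlow : (M + 2 : ℕ) * n ≤ ∑ j, p j ^ 2 := by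
    have h1 : ∑ j, p j ^ 2 = ∑ v, ∑ w, (N v w : ℝ) ^ 2 := by
      have hl : ∀ j, p j ^ 2 = ∑ d ∈ Finset.range (M + 2), ∑ e ∈ Finset.range (M + 2),
          sphereEval 1 (x j) d * sphereEval 1 (x j) e := fun j => by
        rw [pow_two, hp, Finset.sum_mul_sum]
      have hr : ∀ v w, (N v w : ℝ) ^ 2 = ∑ d ∈ Finset.range (M + 2),
          ∑ e ∈ Finset.range (M + 2), (sphereKernel X Γ d v w : ℝ) * sphereKernel X Γ e v w :=
        fun v w => by
          rw [pow_two, hN]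
          push_cast
          rw [Finset.sum_mul_sum]
      simp only [hl, hr]
      rw [Finset.sum_comm]
      have hrc : ∀ v, ∑ w, ∑ d ∈ Finset.range (M + 2), ∑ e ∈ Finset.range (M + 2),
          (sphereKernel X Γ d v w : ℝ) * sphereKernel X Γ e v w =
          ∑ d ∈ Finset.range (M + 2), ∑ e ∈ Finset.range (M + 2), ∑ w,
          (sphereKernel X Γ d v w : ℝ) * sphereKernel X Γ e v w := fun v => by
        rw [Finset.sum_comm]
        exact Finset.sum_congr rfl fun d _ => Finset.sum_comm
      simp only [hrc]
      rw [Finset.sum_comm (s := (Finset.univ : Finset (Vert X Γ)))]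
      refine Finset.sum_congr rfl fun d _ => ?_
      rw [Finset.sum_comm (s := (Finset.univ : Finset (Vert X Γ))),
        Finset.sum_comm (s := (Finset.univ : Finset ι))]
      exact Finset.sum_congr rfl fun e _ => sum_sphereEval_mul_sphereEval hX hreg hψ d e
    rw [h1]
    -- The entries of the kernel are natural numbers, hence at most their squares.
    have h2 : ∀ v, ((M + 2 : ℕ) : ℝ) ≤ ∑ w, (N v w : ℝ) ^ 2 := by
      intro v
      have h3 : ∑ w, (N v w : ℝ) = ∑ d ∈ Finset.range (M + 2),
          sphereEval 1 (((1 : ℕ) : ℝ) + 1) d := by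
        simp only [hN]
        push_cast
        rw [Finset.sum_comm]
        refine Finset.sum_congr rfl fun d _ => ?_
        have := sum_sphereKernel (Γ := Γ) hX hreg d v
        simpa using this
      calc ((M + 2 : ℕ) : ℝ) = ∑ _d ∈ Finset.range (M + 2), (1 : ℝ) := by simp
        _ ≤ ∑ w, (N v w : ℝ) := by
            rw [h3]
            exact Finset.sum_le_sum fun d _ => hσ d
        _ ≤ ∑ w, (N v w : ℝ) ^ 2 := by
            refine Finset.sum_le_sum fun w _ => ?_
            exact_mod_cast Nat.le_self_pow two_ne_zero (N v w)
    calc (M + 2 : ℕ) * n = ∑ _v : Vert X Γ, ((M + 2 : ℕ) : ℝ) := by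
          rw [Finset.sum_const, Finset.card_univ, nsmul_eq_mul, mul_comm]
      _ ≤ _ := Finset.sum_le_sum fun v _ => h2 v
  have hup : ∑ j, p j ^ 2 ≤ (2 * (M + 2 : ℕ)) ^ 2 + (C / β) ^ 2 * n := by
    have hj : ∀ j, p j ^ 2 ≤ (if x j = (1 : ℕ) + 1 then (2 * ((M + 2 : ℕ) : ℝ)) ^ 2 else 0)
        + (C / β) ^ 2 := by
      intro j
      rcases hx j with h | h
      · rw [if_pos h]
        have hp0 : 0 ≤ p j := Finset.sum_nonneg fun d _ => by
          rw [h]; linarith [hσ d]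
        have hp2 : p j ≤ 2 * (M + 2 : ℕ) := by
          calc p j ≤ ∑ _d ∈ Finset.range (M + 2), (2 : ℝ) := by
                refine Finset.sum_le_sum fun d _ => ?_
                rw [h, show ((1 : ℕ) : ℝ) + 1 = 2 by norm_num]
                rcases d with _ | d
                · simp [sphereEval]
                · rw [sphereEval_one_two]
            _ = _ := by
                rw [Finset.sum_const, Finset.card_range, nsmul_eq_mul, mul_comm]
        have := pow_le_pow_left₀ hp0 hp2 2
        linarith [sq_nonneg (C / β)]
      · have hb := hdecay (x j) (h.trans (by push_cast; linarith)) (h.trans (by norm_num))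
        have h1 := hb (M + 2)
        have h2 := hb (M + 1)
        rw [one_pow, mul_one] at h1 h2
        have h3 : |x j - 2| * |p j| ≤ 2 * C := by
          rw [← abs_mul, hp, sub_two_mul_sum_sphereEval_one]
          exact (abs_sub _ _).trans (by linarith)
        have h4 : 2 * β ≤ |x j - 2| := by
          have := le_of_abs_le h
          push_cast at this
          rw [abs_sub_comm]
          exact le_trans (by linarith) (le_abs_self _)
        have h5 : |p j| ≤ C / β := by
          rw [le_div_iff₀ hβ]
          nlinarith [abs_nonneg (p j)]
        have h6 : p j ^ 2 ≤ (C / β) ^ 2 := by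
          rw [← sq_abs]
          exact pow_le_pow_left₀ (abs_nonneg _) h5 2
        split_ifs
        · linarith [sq_nonneg (2 * ((M + 2 : ℕ) : ℝ))]
        · linarith
    refine (Finset.sum_le_sum fun j _ => hj j).trans ?_
    rw [Finset.sum_add_distrib, ← Finset.sum_filter, Finset.sum_const, Finset.sum_const,
      Finset.card_univ, nsmul_eq_mul, nsmul_eq_mul]
    have hcard1 : (Finset.univ.filter (fun j => x j = (1 : ℕ) + 1)).card ≤ 1 := by
      refine Finset.card_le_one.2 fun i hi j hj => ?_
      rw [Finset.mem_filter] at hi hj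
      exact eq_of_trivial_eigenvalue hX.connected hreg hψ hi.2 hj.2
    have hcardι : (Fintype.card ι : ℝ) = n := by
      rw [hn, ← Module.finrank_eq_card_basis ψ.toBasis, finrank_euclideanSpace]
    rw [hcardι, mul_comm n]
    have hcard1' : ((Finset.univ.filter (fun j => x j = (1 : ℕ) + 1)).card : ℝ) ≤ 1 := by
      exact_mod_cast hcard1
    have := mul_le_mul_of_nonneg_right hcard1' (sq_nonneg (2 * ((M + 2 : ℕ) : ℝ)))
    rw [one_mul] at this
    refine add_le_add (le_trans (le_of_eq ?_) this) le_rfl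
    congr!
  have hn0 : 0 ≤ n := Nat.cast_nonneg _
  have hM2 : (C / β) ^ 2 + 1 ≤ ((M + 2 : ℕ) : ℝ) := by
    push_cast
    linarith
  have := mul_le_mul_of_nonneg_right hM2 hn0
  linarith

end QuantumErgodicity

/-! ### Quantum ergodicity -/

theorem theorem1p1 {T : Type*} (q : ℕ) (X : SimpleGraph T) [X.LocallyFinite]
    (hX : X.IsTree) (hreg : X.IsRegularOfDegree (q + 1))
    (Γ : ℕ → Subgroup (X ≃g X)) (hfree : ∀ N, QuantumErgodicity.ActsFreely X (Γ N))
    [∀ N, Fintype (QuantumErgodicity.Vert X (Γ N))]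
    (hcard : Tendsto (fun N => Fintype.card (QuantumErgodicity.Vert X (Γ N))) atTop atTop)
    (hEXP : QuantumErgodicity.IsExpanding X Γ q)
    (hBST : QuantumErgodicity.ConvergesToTree X Γ)
    (ψ : ∀ N, OrthonormalBasis (Fin (Fintype.card (QuantumErgodicity.Vert X (Γ N)))) ℂ
      (EuclideanSpace ℂ (QuantumErgodicity.Vert X (Γ N))))
    (hψ : ∀ N j, ∃ l : ℂ, QuantumErgodicity.adjOp X (Γ N) (ψ N j) = l • ψ N j)
    (a : ∀ N, QuantumErgodicity.Vert X (Γ N) → ℂ) (ha : ∀ N x, ‖a N x‖ ≤ 1) :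
    Tendsto (fun N =>
      (1 / (Fintype.card (QuantumErgodicity.Vert X (Γ N)) : ℝ)) *
        ∑ j, ‖inner ℂ (ψ N j) (WithLp.toLp 2 (fun x => a N x * ψ N j x))
          - (1 / (Fintype.card (QuantumErgodicity.Vert X (Γ N)) : ℂ)) * ∑ x, a N x‖ ^ 2)
      atTop (𝓝 0) := by
  open QuantumErgodicity in
  obtain ⟨β, hβ, hspec⟩ := hEXP
  choose x hx hgap using fun N => exists_isEigenbasis (hspec N) (hψ N)
  -- A large quotient with a spectral gap has degree at least three.
  have hq : 2 ≤ q := by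
    by_contra! hlt
    interval_cases q
    · obtain ⟨N, hN⟩ := (hcard.eventually_ge_atTop 3).exists
      have := card_vert_le_two (Γ := Γ N) hX hreg
      omega
    · obtain ⟨B, hB⟩ := exists_card_vert_le hX hreg hβ
      obtain ⟨m, hm⟩ := exists_nat_gt B
      obtain ⟨N, hN⟩ := (hcard.eventually_ge_atTop m).exists
      have h1 := hB (Γ N) (ψ N) (x N) (hx N) (hgap N)
      have h2 : (m : ℝ) ≤ Fintype.card (Vert X (Γ N)) := by exact_mod_cast hN
      linarith
  have hne : ∀ N, Nonempty (Vert X (Γ N)) := fun N => by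
    obtain ⟨y⟩ := hX.connected.nonempty
    exact ⟨proj X (Γ N) y⟩
  have hn0 : ∀ N, (0 : ℝ) < Fintype.card (Vert X (Γ N)) := fun N => by
    exact_mod_cast Fintype.card_pos
  set mean : ∀ N, ℂ := fun N => (1 / (Fintype.card (Vert X (Γ N)) : ℂ)) * ∑ x, a N x with hmean
  set b : ∀ N, Vert X (Γ N) → ℂ := fun N v => a N v - mean N with hb
  have hb0 : ∀ N, ∑ v, b N v = 0 := fun N => by
    have h : (Fintype.card (Vert X (Γ N)) : ℂ) ≠ 0 := by exact_mod_cast (hn0 N).ne'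
    simp only [hb, Finset.sum_sub_distrib, Finset.sum_const, Finset.card_univ, nsmul_eq_mul]
    rw [hmean]
    field_simp
    ring
  have hb2 : ∀ N v, ‖b N v‖ ≤ 2 := fun N v => by
    have hm : ‖mean N‖ ≤ 1 := by
      rw [hmean, norm_mul, norm_div, norm_one, Complex.norm_natCast, one_div,
        inv_mul_le_iff₀ (hn0 N), mul_one]
      calc ‖∑ x, a N x‖ ≤ ∑ x, ‖a N x‖ := norm_sum_le _ _
        _ ≤ ∑ _x : Vert X (Γ N), (1 : ℝ) := Finset.sum_le_sum fun v _ => ha N v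
        _ = _ := by simp
    exact (norm_sub_le _ _).trans (by linarith [ha N v])
  have hcoeff : ∀ N j, inner ℂ (ψ N j) (WithLp.toLp 2 (fun x => a N x * ψ N j x)) - mean N =
      matrixCoeff (ψ N) (b N) j j := fun N j => by
    have h1 : ∑ v, ψ N j v * (starRingEnd ℂ) (ψ N j v) = 1 := by
      rw [← inner_toLp_eq_sum (ψ N) (fun v => ψ N j v) j]
      exact (inner_self_eq_norm_sq_to_K (𝕜 := ℂ) (ψ N j)).trans (by simp)
    change matrixCoeff (ψ N) (a N) j j - mean N = _
    rw [matrixCoeff_eq_sum, matrixCoeff_eq_sum]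
    simp only [hb, sub_mul, Finset.sum_sub_distrib]
    rw [← Finset.mul_sum, h1, mul_one]
  simp only [hmean] at hcoeff
  simp only [hcoeff]
  obtain ⟨K, hK, hest⟩ := exists_sum_norm_matrixCoeff_le hq hX hreg hβ
  rw [Metric.tendsto_atTop]
  intro ε hε
  obtain ⟨M, hM⟩ := exists_nat_gt (2 * K / ε)
  have hM0 : (0 : ℝ) < M := lt_of_le_of_lt (by positivity) hM
  have hMn : 0 < M := by exact_mod_cast hM0
  obtain ⟨E, hE, hest⟩ := hest M hMn
  have hlim := (hBST (4 * M)).const_mul E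
  rw [mul_zero] at hlim
  obtain ⟨N₀, hN₀⟩ := Filter.eventually_atTop.1 (hlim.eventually_lt_const (half_pos hε))
  refine ⟨N₀, fun N hN => ?_⟩
  have hNN := hN₀ N hN
  have hle := hest (Γ N) (hfree N) (ψ N) (x N) (hx N) (hgap N) (b N) (hb0 N) (hb2 N)
  rw [Real.dist_eq, sub_zero, abs_of_nonneg (mul_nonneg (by have := hn0 N; positivity)
    (Finset.sum_nonneg fun _ _ => sq_nonneg _)), one_div, inv_mul_lt_iff₀ (hn0 N)]
  refine hle.trans_lt ?_
  have h1 : K / M < ε / 2 := by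
    rw [div_lt_iff₀ hε] at hM
    rw [div_lt_iff₀ hM0]
    linarith
  have h2 : E * ({v : Vert X (Γ N) | injRadius X (Γ N) v < (4 * M : ℕ)}.ncard : ℝ) <
      ε / 2 * Fintype.card (Vert X (Γ N)) := by
    rwa [← mul_div_assoc, div_lt_iff₀ (hn0 N)] at hNN
  have h3 := mul_lt_mul_of_pos_right h1 (hn0 N)
  linarith
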